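/- **Setting.** A network consists of a finite set $V$ of parties and a finite family of sources $s\in S$; source $s$ sends one subsystem to each party of a set $\mathrm{parties}(s)\subseteq V$. The network has bipartite sources if $|\mathrm{parties}(s)|=2$ for every $s$. A state $\varrho$ of the parties, where party $v$ has a finite local dimension $d_v$, *can be prepared in the network* if $$\varrho=\sum_\lambda p_\lambda\Big(\bigotimes_{v\in V}\mathcal E_v^{(\lambda)}\Big)\Big[\bigotimes_{s\in S}\sigma_s\Big],$$ where the source states $\sigma_s$ are density matrices on the subsystems sent out by $s$ (of arbitrary finite dimensions), $p$ is a probability distribution of a discrete shared random variable $\lambda$, and each $\mathcal E_v^{(\lambda)}$ is a quantum channel (completely positive trace-preserving map) from the total system received by $v$ to $\mathbb C^{d_v}$. Write $\langle M\rangle=\mathrm{Tr}(\varrho M)$, and let $X,Y,Z$ be the Pauli matrices. **Observation (link certification).** Let $A\neq C$ be two qubit parties ($d_A=d_C=2$) of a network with bipartite sources. Let $R_1,R_2,R_3\subseteq V\setminus\{A,C\}$ be pairwise disjoint, and for $i=1,2,3$ let $P_{R_i}$ be an arbitrary observable on the parties in $R_i$ with eigenvalues in $[-1,1]$ (for instance,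 with eigenvalues $\pm1$). 1. If the network has no link between $A$ and $C$ (no source is shared by $A$ and $C$) and $\varrho$ can be prepared in it, then $$\langle X_AX_CP_{R_1}\rangle^2+\langle Y_AY_CP_{R_2}\rangle^2+\langle Z_AZ_CP_{R_3}\rangle^2\le 1.$$ 2. Consequently a violation of this inequality certifies the link: if $\varrho$ is prepared in a network with bipartite sources, possibly with links between $A$ and $C$, and violates the inequality, then in every such preparation at least one source shared by $A$ and $C$ emits an entangled (non-separable) state. -/

import Mathlib

noncomputable section

namespace QNetwork

open scoped ComplexOrder

/-- A density matrix: positive semidefinite with unit trace. -/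
def IsDensity {n : Type*} [Fintype n] (ρ : Matrix n n ℂ) : Prop :=
  ρ.PosSemidef ∧ ρ.trace = 1

/-- The ampliation `id_k ⊗ Φ`, acting on `k × k` block matrices by applying `Φ` to each block. -/
def ampliation {m n : Type*} (Φ : Matrix m m ℂ →ₗ[ℂ] Matrix n n ℂ) (k : ℕ)
    (X : Matrix (Fin k × m) (Fin k × m) ℂ) : Matrix (Fin k × n) (Fin k × n) ℂ :=
  Matrix.of fun x y => Φ (Matrix.of fun a b => X (x.1, a) (y.1, b)) x.2 y.2

/-- A quantum channel: a completely positive, trace preserving linear map. -/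
structure IsChannel {m n : Type*} [Fintype m] [Fintype n]
    (Φ : Matrix m m ℂ →ₗ[ℂ] Matrix n n ℂ) : Prop where
  completelyPositive : ∀ (k : ℕ) (X : Matrix (Fin k × m) (Fin k × m) ℂ),
    X.PosSemidef → (ampliation Φ k X).PosSemidef
  tracePreserving : ∀ X : Matrix m m ℂ, (Φ X).trace = X.trace

/-- The tensor product `⨂ᵥ Mᵥ` of a finite family of matrices. -/
def tensor {V : Type*} [Fintype V] {I : V → Type*}
    (M : ∀ v, Matrix (I v) (I v) ℂ) : Matrix (∀ v, I v) (∀ v, I v) ℂ :=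
  Matrix.of fun x y => ∏ v, M v (x v) (y v)

/-- The tensor product `⨂ᵥ Φᵥ` of a finite family of linear maps of matrices, applied to `X`: it is
obtained by expanding `X = ∑ X a b • ⨂ᵥ |aᵥ⟩⟨bᵥ|` and sending each `⨂ᵥ |aᵥ⟩⟨bᵥ|` to
`⨂ᵥ Φᵥ (|aᵥ⟩⟨bᵥ|)`. -/
def tensorMap {V : Type*} [Fintype V] [DecidableEq V] {I O : V → Type*}
    [∀ v, Fintype (I v)] [∀ v, DecidableEq (I v)]
    (Φ : ∀ v, Matrix (I v) (I v) ℂ →ₗ[ℂ] Matrix (O v) (O v) ℂ)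
    (X : Matrix (∀ v, I v) (∀ v, I v) ℂ) : Matrix (∀ v, O v) (∀ v, O v) ℂ :=
  ∑ a, ∑ b, X a b • tensor (fun v => Φ v (Matrix.single (a v) (b v) 1))

/-- A multipartite density matrix is (fully) separable if it is a finite convex combination of
tensor products of density matrices. -/
def IsSeparable {V : Type*} [Fintype V] {I : V → Type*} [∀ v, Fintype (I v)]
    (ρ : Matrix (∀ v, I v) (∀ v, I v) ℂ) : Prop :=
  ∃ (k : ℕ) (q : Fin k → ℝ) (ω : Fin k → ∀ v, Matrix (I v) (I v) ℂ),
    (∀ i, 0 ≤ q i) ∧ ∑ i, q i = 1 ∧ (∀ i v, IsDensity (ω i v)) ∧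
      ρ = ∑ i, (q i : ℂ) • tensor (ω i)

/-- A network is given by a set `V` of parties, a set `S` of sources, and for each source the set
`parties s` of parties to which it sends one subsystem each. If the subsystem that `s` sends to `v`
has dimension `D s v`, this is the index set of the basis of the total input system of `v`. -/
abbrev InputIndex {V S : Type*} [DecidableEq V] (parties : S → Finset V) (D : S → V → ℕ) (v : V) :
    Type _ :=
  ∀ s : {s : S // v ∈ parties s}, Fin (D s.1 v)

/-- The joint state `⨂ₛ σₛ` of all sources, with the subsystems regrouped by the party that
receives them. -/
def jointSource {V S : Type*} [DecidableEq V] [Fintype S] (parties : S → Finset V) (D : S → V → ℕ)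
    (σ : ∀ s, Matrix (∀ v : {v // v ∈ parties s}, Fin (D s v.1))
      (∀ v : {v // v ∈ parties s}, Fin (D s v.1)) ℂ) :
    Matrix (∀ v, InputIndex parties D v) (∀ v, InputIndex parties D v) ℂ :=
  Matrix.of fun x y => ∏ s, σ s (fun v => x v.1 ⟨s, v.2⟩) (fun v => y v.1 ⟨s, v.2⟩)

/-- A preparation of the state `ρ`, on parties `v : V` with local dimensions `d v`, in a network by
local operations and shared randomness: the sources emit independent states of arbitrary finite
dimension, the parties share a discrete random variable `l` with distribution `prob`, and party `v`
applies the channel `channel l v` to everything that it receives. -/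
structure Preparation {V S : Type*} [Fintype V] [DecidableEq V] [Fintype S] [DecidableEq S]
    (parties : S → Finset V) (d : V → ℕ)
    (ρ : Matrix (∀ v, Fin (d v)) (∀ v, Fin (d v)) ℂ) where
  D : S → V → ℕ
  source : ∀ s, Matrix (∀ v : {v // v ∈ parties s}, Fin (D s v.1))
    (∀ v : {v // v ∈ parties s}, Fin (D s v.1)) ℂ
  source_isDensity : ∀ s, IsDensity (source s)
  Λ : Type
  prob : Λ → ℝ
  prob_nonneg : ∀ l, 0 ≤ prob l
  prob_sum : HasSum prob 1
  channel : Λ → ∀ v, Matrix (InputIndex parties D v) (InputIndex parties D v) ℂ →ₗ[ℂ]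
    Matrix (Fin (d v)) (Fin (d v)) ℂ
  channel_isChannel : ∀ l v, IsChannel (channel l v)
  state_eq : HasSum
    (fun l => (prob l : ℂ) • tensorMap (channel l) (jointSource parties D source)) ρ

/-- The state `ρ` can be prepared in the network. -/
def IsPreparable {V S : Type*} [Fintype V] [DecidableEq V] [Fintype S] [DecidableEq S]
    (parties : S → Finset V) (d : V → ℕ)
    (ρ : Matrix (∀ v, Fin (d v)) (∀ v, Fin (d v)) ℂ) : Prop :=
  Nonempty (Preparation parties d ρ)

/-- An observable (Hermitian matrix) with all eigenvalues in `[-1, 1]`. -/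
def IsBoundedObservable {n : Type*} [DecidableEq n] (P : Matrix n n ℂ) : Prop :=
  P.IsHermitian ∧ (1 - P).PosSemidef ∧ (1 + P).PosSemidef

/-- The operator `P ⊗ 1` on all parties, for an operator `P` on the parties in `R`. -/
def onSet {V : Type*} [Fintype V] [DecidableEq V] {d : V → ℕ} (R : Finset V)
    (P : Matrix (∀ v : {v // v ∈ R}, Fin (d v.1)) (∀ v : {v // v ∈ R}, Fin (d v.1)) ℂ) :
    Matrix (∀ v, Fin (d v)) (∀ v, Fin (d v)) ℂ :=
  Matrix.of fun x y =>
    if ∀ v, v ∉ R → x v = y v then P (fun v => x v.1) (fun v => y v.1) else 0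

/-- The operator `M ⊗ 1` on all parties, for an operator `M` on the single qubit party `v`. -/
def onQubit {V : Type*} [Fintype V] [DecidableEq V] {d : V → ℕ} (v : V) (hv : d v = 2)
    (M : Matrix (Fin 2) (Fin 2) ℂ) : Matrix (∀ v, Fin (d v)) (∀ v, Fin (d v)) ℂ :=
  Matrix.of fun x y =>
    if ∀ w, w ≠ v → x w = y w then M (Fin.cast hv (x v)) (Fin.cast hv (y v)) else 0

/-- The expectation value of the observable `M` in the state `ρ`; `Tr (ρ M)` is real for Hermitian
matrices `ρ` and `M`. -/
def mean {n : Type*} [Fintype n] (ρ M : Matrix n n ℂ) : ℝ := (ρ * M).trace.re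

def pauliX : Matrix (Fin 2) (Fin 2) ℂ := !![0, 1; 1, 0]

def pauliY : Matrix (Fin 2) (Fin 2) ℂ := !![0, -Complex.I; Complex.I, 0]

def pauliZ : Matrix (Fin 2) (Fin 2) ℂ := !![1, 0; 0, -1]

end QNetwork

end

/-! Fix the shared randomness and suppose that every source reaching both `A` and `C` emits a
product state. The joint state is then `ω ⊗ κ`, where `κ` lives on what parties other than `A`
receive from sources reaching `C`, and `ω` on all the rest (`exists_jointSource_factors`). Pull the
observables of all parties but `A` back through their channels and average them over `κ`. This
removes every input of `C`, so the effective observables `F i` act nontrivially only on the pairwise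
disjoint sets `R i` and therefore commute (`idAt_effectiveObs`, `IdAt.commute`); they still satisfy
`-1 ≤ F i ≤ 1`.

Commuting `F i` make the operators `T i = σ i ⊗ F i`, with `σ i` the Paulis of `A`, anticommute.
With `G = ∑ c i • T i`, the positive operator `(1 - G)² + ∑ c i² (1 - T i²)` equals `1 + ∑ c i² - 2
G`, so `2 ⟨G⟩ ≤ 1 + ∑ c i²` for all real `c` (`posSemidef_of_anticommute`, `steering_bound`).

For fixed `c` this bound is linear in the state. It thus survives mixing over product decompositions
of separable sources (`separable_network_bound`) and over the shared randomness. Only then is `c`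
set to the correlations themselves, which gives `∑ c i² ≤ 1` (`Preparation.sum_sq_mean_le`). Both
claims follow: the first has no source reaching both parties, the second is the contrapositive. -/

noncomputable section

namespace QNetwork

open scoped ComplexOrder Kronecker MatrixOrder

/-! ### Positivity of Hadamard and tensor products -/

section Positivity

theorem posSemidef_hadamard {n : Type*} {M N : Matrix n n ℂ} (hM : M.PosSemidef)
    (hN : N.PosSemidef) : (M.hadamard N).PosSemidef :=
  hM.hadamard hN

theorem posSemidef_kronecker {m n : Type*} [Finite m] [Finite n] {M : Matrix m m ℂ}
    {N : Matrix n n ℂ} (hM : M.PosSemidef) (hN : N.PosSemidef) : (M ⊗ₖ N).PosSemidef :=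
  hM.kronecker hN

/-- Iterated Schur product theorem; the empty product is the rank-one all-ones matrix. Tensor
products and products over sources are both entrywise products of pulled-back factors, so their
positivity reduces to this. -/
theorem posSemidef_hadamardProd {ι n : Type*} [Fintype n] (s : Finset ι)
    (M : ι → Matrix n n ℂ) (h : ∀ i ∈ s, (M i).PosSemidef) :
    (Matrix.of fun x y => ∏ i ∈ s, M i x y).PosSemidef := by
  classical
  induction s using Finset.induction_on with
  | empty =>
    have := Matrix.posSemidef_vecMulVec_self_star (R := ℂ) (fun _ : n => (1 : ℂ))
    convert this using 1
    ext x y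
    simp [Matrix.vecMulVec]
  | insert i s hi ih =>
    have := posSemidef_hadamard (h i (Finset.mem_insert_self _ _))
      (ih fun j hj => h j (Finset.mem_insert_of_mem hj))
    convert this using 1
    ext x y
    simp [Finset.prod_insert hi]

theorem posSemidef_ones (n : Type*) [Fintype n] :
    (Matrix.of fun _ _ : n => (1 : ℂ)).PosSemidef := by
  simpa using posSemidef_hadamardProd (∅ : Finset ℕ) (fun _ => (0 : Matrix n n ℂ)) (by simp)

theorem posSemidef_tensor {V : Type*} [Fintype V] {I : V → Type*} [∀ v, Fintype (I v)]
    [DecidableEq V] {M : ∀ v, Matrix (I v) (I v) ℂ} (h : ∀ v, (M v).PosSemidef) :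
    (tensor M).PosSemidef :=
  posSemidef_hadamardProd Finset.univ
    (fun v => (M v).submatrix (fun x : ∀ v, I v => x v) (fun x => x v))
    fun v _ => (h v).submatrix _

theorem trace_tensor {V : Type*} [Fintype V] {I : V → Type*} [∀ v, Fintype (I v)]
    [DecidableEq V] (M : ∀ v, Matrix (I v) (I v) ℂ) :
    (tensor M).trace = ∏ v, (M v).trace := by
  simp only [Matrix.trace, Matrix.diag, tensor, Matrix.of_apply]
  rw [Finset.prod_univ_sum, Fintype.piFinset_univ]

theorem IsDensity.tensor {V : Type*} [Fintype V] {I : V → Type*} [∀ v, Fintype (I v)]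
    [DecidableEq V] {M : ∀ v, Matrix (I v) (I v) ℂ} (h : ∀ v, IsDensity (M v)) :
    IsDensity (tensor M) :=
  ⟨posSemidef_tensor fun v => (h v).1, by simp [trace_tensor, (h _).2]⟩

end Positivity

/-! ### Choi kernels and Heisenberg duals -/

section Heisenberg

/-- The Choi kernel `e a b = Φ (|a⟩⟨b|)` of a completely positive trace preserving map `Φ`. -/
structure IsChoi {I O : Type*} [Fintype O] [DecidableEq I] (e : I → I → Matrix O O ℂ) : Prop where
  posSemidef : (Matrix.of fun p q : I × O => e p.1 q.1 p.2 q.2).PosSemidef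
  trace_eq : ∀ a b, (e a b).trace = if a = b then 1 else 0

/-- The Heisenberg dual of the map with Choi kernel `e`, as a map on observables. -/
def heis {I O : Type*} [Fintype O] (e : I → I → Matrix O O ℂ) (N : Matrix O O ℂ) :
    Matrix I I ℂ :=
  Matrix.of fun b a => (e a b * N).trace

variable {I O : Type*} [Fintype O]

theorem heis_apply (e : I → I → Matrix O O ℂ) (N : Matrix O O ℂ) (b a : I) :
    heis e N b a = ∑ x, ∑ y, e a b x y * N y x := by
  simp [heis, Matrix.trace, Matrix.mul_apply]

theorem heis_add (e : I → I → Matrix O O ℂ) (M N : Matrix O O ℂ) :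
    heis e (M + N) = heis e M + heis e N := by
  ext; simp [heis, mul_add]

theorem heis_sub (e : I → I → Matrix O O ℂ) (M N : Matrix O O ℂ) :
    heis e (M - N) = heis e M - heis e N := by
  ext; simp [heis, mul_sub]

theorem heis_smul (e : I → I → Matrix O O ℂ) (c : ℂ) (N : Matrix O O ℂ) :
    heis e (c • N) = c • heis e N := by
  ext; simp [heis]

theorem heis_sum {ι : Type*} (e : I → I → Matrix O O ℂ) (s : Finset ι) (N : ι → Matrix O O ℂ) :
    heis e (∑ i ∈ s, N i) = ∑ i ∈ s, heis e (N i) := by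
  ext; simp [heis, Finset.mul_sum, Matrix.sum_apply, Matrix.trace_sum]

theorem heis_one [DecidableEq I] [DecidableEq O] {e : I → I → Matrix O O ℂ} (he : IsChoi e) :
    heis e 1 = 1 := by
  ext a b
  simp [heis, he.trace_eq, Matrix.one_apply, eq_comm]

/-- The dual is a compression of the Hadamard product of the transposed Choi matrix with `N` pulled
back to `I × O`; the compressing matrix sums out the `O` coordinate. -/
theorem heis_posSemidef [Fintype I] [DecidableEq I] {e : I → I → Matrix O O ℂ} (he : IsChoi e)
    {N : Matrix O O ℂ} (hN : N.PosSemidef) : (heis e N).PosSemidef := by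
  have h1 := posSemidef_hadamard he.posSemidef.transpose (hN.submatrix (Prod.snd : I × O → O))
  have h2 := h1.conjTranspose_mul_mul_same
    (Matrix.of fun (p : I × O) (a : I) => if p.1 = a then (1 : ℂ) else 0)
  convert h2 using 1
  ext b a
  rw [heis_apply]
  simp only [Matrix.mul_apply, Matrix.conjTranspose_apply, Matrix.of_apply, Fintype.sum_prod_type,
    Matrix.hadamard_apply, Matrix.transpose_apply, Matrix.submatrix_apply]
  simp [Finset.sum_ite_irrel]


/-- A matrix `F` with `-1 ≤ F ≤ 1`. -/
def IsContr {n : Type*} [DecidableEq n] (P : Matrix n n ℂ) : Prop :=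
  (1 - P).PosSemidef ∧ (1 + P).PosSemidef

theorem IsContr.heis [Fintype I] [DecidableEq I] [DecidableEq O] {e : I → I → Matrix O O ℂ}
    (he : IsChoi e) {N : Matrix O O ℂ} (hN : IsContr N) : IsContr (heis e N) := by
  constructor
  · rw [← heis_one he, ← heis_sub]; exact heis_posSemidef he hN.1
  · rw [← heis_one he, ← heis_add]; exact heis_posSemidef he hN.2

theorem IsContr.isHermitian {n : Type*} [DecidableEq n] {P : Matrix n n ℂ} (h : IsContr P) :
    P.IsHermitian := by
  have := h.2.isHermitian
  have h1 : P = (1 + P) - 1 := by abel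
  rw [h1]
  exact this.sub Matrix.isHermitian_one

theorem IsContr.submatrix {n m : Type*} [DecidableEq n] [DecidableEq m] {P : Matrix n n ℂ}
    (h : IsContr P) {f : m → n} (hf : Function.Injective f) : IsContr (P.submatrix f f) := by
  constructor
  · rw [← Matrix.submatrix_one f hf]; exact h.1.submatrix f
  · rw [← Matrix.submatrix_one f hf]; exact h.2.submatrix f

theorem IsChoi.of_channel {I' : Type*} [Fintype I'] [DecidableEq I']
    {Φ : Matrix I' I' ℂ →ₗ[ℂ] Matrix O O ℂ} (h : IsChannel Φ) :
    IsChoi fun a b => Φ (Matrix.single a b 1) := by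
  refine ⟨?_, fun a b => ?_⟩
  · let ε := Fintype.equivFin I'
    -- The unnormalized maximally entangled projector: the ampliation of `Φ` sends it to the Choi
    -- matrix.
    have h1 : (Matrix.vecMulVec (fun p : Fin (Fintype.card I') × I' => if ε.symm p.1 = p.2 then (1 : ℂ) else 0)
      (star fun p : Fin (Fintype.card I') × I' => if ε.symm p.1 = p.2 then (1 : ℂ) else 0)).PosSemidef :=
      Matrix.posSemidef_vecMulVec_self_star _
    have h2 := (h.completelyPositive _ _ h1).submatrix (fun p : I' × O => (ε p.1, p.2))
    convert h2 using 1
    ext p q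
    simp only [Matrix.of_apply, Matrix.submatrix_apply, ampliation]
    refine congrArg (fun X => Φ X p.2 q.2) ?_
    ext a b
    simp [Matrix.single, Matrix.vecMulVec, ← ite_and, and_comm]
  · rw [h.tracePreserving]
    by_cases hab : a = b
    · subst hab; simp
    · simp [hab]

theorem IsChoi.kron {I' O' : Type*} [Fintype O'] [DecidableEq I] [DecidableEq I']
    {e : I → I → Matrix O O ℂ} {e' : I' → I' → Matrix O' O' ℂ} (he : IsChoi e) (he' : IsChoi e')
    [Fintype I] [Fintype I'] :
    IsChoi fun a b : I × I' => e a.1 b.1 ⊗ₖ e' a.2 b.2 := by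
  refine ⟨?_, fun a b => ?_⟩
  · have := (posSemidef_kronecker he.posSemidef he'.posSemidef).submatrix
      (fun p : (I × I') × O × O' => ((p.1.1, p.2.1), (p.1.2, p.2.2)))
    convert this using 1
    ext p q
    rfl
  · rw [Matrix.trace_kronecker, he.trace_eq, he'.trace_eq]
    simp [Prod.ext_iff, ← ite_and, and_comm]

theorem heis_kron {I' O' : Type*} [Fintype O'] (e : I → I → Matrix O O ℂ)
    (e' : I' → I' → Matrix O' O' ℂ) (M : Matrix O O ℂ) (N : Matrix O' O' ℂ) :
    heis (fun a b : I × I' => e a.1 b.1 ⊗ₖ e' a.2 b.2) (M ⊗ₖ N) = heis e M ⊗ₖ heis e' N := by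
  ext b a
  simp [heis, ← Matrix.mul_kronecker_mul, Matrix.trace_kronecker]

theorem IsChoi.id [DecidableEq O] : IsChoi fun a b : O => Matrix.single a b (1 : ℂ) := by
  refine ⟨?_, fun a b => ?_⟩
  · have h1 := Matrix.posSemidef_vecMulVec_self_star
      (fun p : O × O => if p.1 = p.2 then (1 : ℂ) else 0)
    convert h1 using 1
    ext p q
    simp [Matrix.single, Matrix.vecMulVec, ← ite_and, and_comm]
  · by_cases hab : a = b
    · subst hab; simp
    · simp [hab]

theorem heis_id [DecidableEq O] (N : Matrix O O ℂ) :
    heis (fun a b : O => Matrix.single a b (1 : ℂ)) N = N := by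
  ext b a
  simp [heis, Matrix.trace_single_mul]

theorem IsChoi.tensor {V : Type*} [Fintype V] [DecidableEq V] {I O : V → Type*}
    [∀ v, Fintype (I v)] [∀ v, Fintype (O v)] [∀ v, DecidableEq (I v)]
    {e : ∀ v, I v → I v → Matrix (O v) (O v) ℂ} (h : ∀ v, IsChoi (e v)) :
    IsChoi fun a b : ∀ v, I v => QNetwork.tensor fun v => e v (a v) (b v) := by
  refine ⟨?_, fun a b => ?_⟩
  · exact (posSemidef_tensor fun v => (h v).posSemidef).submatrix
      (fun p : (∀ v, I v) × (∀ v, O v) => fun v => (p.1 v, p.2 v))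
  · simp [trace_tensor, (h _).trace_eq, Finset.prod_ite_zero, funext_iff]

theorem trace_mul_nonneg {n : Type*} [Fintype n] [DecidableEq n] {M N : Matrix n n ℂ}
    (hM : M.PosSemidef) (hN : N.PosSemidef) : 0 ≤ (M * N).trace := by
  obtain ⟨B, rfl⟩ := CStarAlgebra.nonneg_iff_eq_star_mul_self.mp hN.nonneg
  rw [Matrix.star_eq_conjTranspose]
  rw [← mul_assoc, Matrix.trace_mul_comm, ← mul_assoc]
  exact (hM.mul_mul_conjTranspose_same B).trace_nonneg

end Heisenberg

/-! ### Operators acting trivially on a tensor factor -/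

section Locality

variable {V : Type*} [DecidableEq V] {I : V → Type*}

/-- The matrix `M` on a tensor product is of the form `1 ⊗ M'` with respect to the factor `v`. -/
def IdAt (v : V) (M : Matrix (∀ v, I v) (∀ v, I v) ℂ) : Prop :=
  (∀ x y, x v ≠ y v → M x y = 0) ∧
    ∀ x y c, x v = y v → M (Function.update x v c) (Function.update y v c) = M x y

theorem IdAt.apply_eq_apply {M : Matrix (∀ v, I v) (∀ v, I v) ℂ} {S : Finset V}
    (h : ∀ v ∈ S, IdAt v M) {x y x' y' : ∀ v, I v} (hxy : ∀ v ∈ S, x v = y v)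
    (hxy' : ∀ v ∈ S, x' v = y' v) (hoff : ∀ v ∉ S, x v = x' v ∧ y v = y' v) :
    M x y = M x' y' := by
  induction S using Finset.induction_on generalizing x y with
  | empty =>
    rw [funext fun v => (hoff v (by simp)).1, funext fun v => (hoff v (by simp)).2]
  | insert v S hv ih =>
    rw [← (h v (by simp)).2 x y (x' v) (hxy v (by simp))]
    refine ih (fun u hu => h u (by simp [hu])) (fun u hu => ?_) (fun u hu => hxy' u (by simp [hu]))
      fun u hu => ?_
    · have : u ≠ v := by rintro rfl; exact hv hu
      simp [this, hxy u (by simp [hu])]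
    · by_cases huv : u = v
      · subst huv; simp [hxy' u (by simp)]
      · simpa [huv] using hoff u (by simp [huv, hu])

/-- With `S` the factors where `M` is trivial, each matrix product has a single surviving
intermediate index, spliced from `x` and `y` along `S`. The entries in the two orders then differ
only in coordinates where the matrix concerned is trivial. -/
theorem IdAt.commute [Fintype V] [∀ v, Fintype (I v)] {M N : Matrix (∀ v, I v) (∀ v, I v) ℂ}
    (h : ∀ v, IdAt v M ∨ IdAt v N) : M * N = N * M := by
  classical
  let S := Finset.univ.filter fun v => IdAt v M
  have hS : ∀ v ∈ S, IdAt v M := by simp [S]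
  have hS' : ∀ v ∈ Sᶜ, IdAt v N := by
    intro v hv
    exact (h v).resolve_left (by simpa [S] using hv)
  ext x y
  have h1 : (M * N) x y = M x (S.piecewise x y) * N (S.piecewise x y) y := by
    rw [Matrix.mul_apply]
    refine Finset.sum_eq_single _ (fun z _ hz => ?_) (by simp)
    obtain ⟨v, hv⟩ := Function.ne_iff.1 hz
    by_cases hvS : v ∈ S
    · rw [(hS v hvS).1 x z (by simpa [hvS] using hv.symm), zero_mul]
    · rw [(hS' v (by simpa using hvS)).1 z y (by simpa [hvS] using hv), mul_zero]
  have h2 : (N * M) x y = N x (S.piecewise y x) * M (S.piecewise y x) y := by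
    rw [Matrix.mul_apply]
    refine Finset.sum_eq_single _ (fun z _ hz => ?_) (by simp)
    obtain ⟨v, hv⟩ := Function.ne_iff.1 hz
    by_cases hvS : v ∈ S
    · rw [(hS v hvS).1 z y (by simpa [hvS] using hv), mul_zero]
    · rw [(hS' v (by simpa using hvS)).1 x z (by simpa [hvS] using hv.symm), zero_mul]
  rw [h1, h2, mul_comm (N _ _)]
  congr 1
  · exact IdAt.apply_eq_apply hS (by simp +contextual) (by simp +contextual)
      (by simp +contextual)
  · exact IdAt.apply_eq_apply hS' (by simp +contextual) (by simp +contextual)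
      (by simp +contextual)

/-- The trace defining the dual factorizes across `v`. With `P = 1` this gives preservation of
locality; with `P` a Pauli matrix it separates `A` from the other parties. -/
theorem heis_tensor_split [Fintype V] {O : V → Type*} [∀ v, Fintype (O v)]
    (e : ∀ v, I v → I v → Matrix (O v) (O v) ℂ) (v : V) {M : Matrix (∀ v, O v) (∀ v, O v) ℂ}
    {P : Matrix (O v) (O v) ℂ} {N : Matrix (∀ u : {u // u ≠ v}, O u) (∀ u : {u // u ≠ v}, O u) ℂ}
    (hM : ∀ x y, M x y = P (x v) (y v) * N (fun u => x u) (fun u => y u)) (b a : ∀ v, I v) :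
    heis (fun a b : ∀ v, I v => tensor fun v => e v (a v) (b v)) M b a =
      heis (e v) P (b v) (a v) *
        heis (fun a b : ∀ u : {u // u ≠ v}, I u =>
            tensor fun u : {u // u ≠ v} => e u (a u) (b u)) N
          (fun u => b u) (fun u => a u) := by
  have key : ∀ (p q : O v) (m n : ∀ u : {u // u ≠ v}, O u),
      tensor (fun v => e v (a v) (b v)) ((Equiv.piSplitAt v O).symm (p, m))
        ((Equiv.piSplitAt v O).symm (q, n)) * M ((Equiv.piSplitAt v O).symm (q, n))
        ((Equiv.piSplitAt v O).symm (p, m)) =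
      (e v (a v) (b v) p q * P q p) *
        (tensor (fun u : {u // u ≠ v} => e u (a u) (b u)) m n * N n m) := by
    intro p q m n
    have hu : ∀ (p : O v) (m : ∀ u : {u // u ≠ v}, O u) (u : {u // u ≠ v}),
        (Equiv.piSplitAt v O).symm (p, m) u = m u := by
      intro p m u
      simp [Equiv.piSplitAt, u.2]
    have hv : ∀ (p : O v) (m : ∀ u : {u // u ≠ v}, O u),
        (Equiv.piSplitAt v O).symm (p, m) v = p := by
      intro p m
      simp [Equiv.piSplitAt]
    rw [hM, tensor, Matrix.of_apply, Fintype.prod_eq_mul_prod_subtype_ne _ v, tensor,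
      Matrix.of_apply]
    simp only [hu, hv]
    ring
  rw [heis_apply, heis_apply, heis_apply, ← (Equiv.piSplitAt v O).symm.sum_comp]
  simp only [← (Equiv.piSplitAt v O).symm.sum_comp (fun y => _ * M y _), key,
    Fintype.sum_prod_type]
  simp only [Finset.sum_mul_sum]

theorem piSplitAt_symm_restrict (v : V) (c : I v) (x : ∀ v, I v) :
    (Equiv.piSplitAt v I).symm (c, fun u => x u) = Function.update x v c := by
  ext u
  by_cases hu : u = v
  · subst hu; simp [Equiv.piSplitAt]
  · simp [Equiv.piSplitAt, hu]

theorem piSplitAt_symm_update (v : V) (c : I v) (m : ∀ u : {u // u ≠ v}, I u)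
    (u : {u // u ≠ v}) (c' : I u) :
    (Equiv.piSplitAt v I).symm (c, Function.update m u c') =
      Function.update ((Equiv.piSplitAt v I).symm (c, m)) u c' := by
  ext w
  by_cases hw : w = v
  · subst hw
    rw [Function.update_of_ne u.2.symm]
    simp [Equiv.piSplitAt]
  · by_cases hwu : w = u
    · obtain ⟨u, hu⟩ := u
      subst hwu
      simp [Equiv.piSplitAt, hw]
    · have : (⟨w, hw⟩ : {u // u ≠ v}) ≠ u := by rintro rfl; exact hwu rfl
      simp [Equiv.piSplitAt, hw, hwu, this]

/-- Trace preservation makes the dual of the channel at `v` unital, so an identity factor at `v` is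
pulled back to an identity factor. -/
theorem IdAt.heis_tensor [Fintype V] {O : V → Type*} [∀ v, Fintype (O v)]
    [∀ v, DecidableEq (I v)]
    {e : ∀ v, I v → I v → Matrix (O v) (O v) ℂ} (he : ∀ v, IsChoi (e v)) {v : V}
    {M : Matrix (∀ v, O v) (∀ v, O v) ℂ} (hM : IdAt v M) :
    IdAt v (heis (fun a b : ∀ v, I v => tensor fun v => e v (a v) (b v)) M) := by
  classical
  rcases isEmpty_or_nonempty (O v) with hO | ⟨⟨c⟩⟩
  · have : IsEmpty (∀ v, O v) := ⟨fun x => hO.elim (x v)⟩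
    constructor <;> intros <;> simp [heis_apply]
  have hM' : ∀ x y, M x y = (1 : Matrix (O v) (O v) ℂ) (x v) (y v) *
      (Matrix.of fun m n => M ((Equiv.piSplitAt v O).symm (c, m))
        ((Equiv.piSplitAt v O).symm (c, n)) :
          Matrix (∀ u : {u // u ≠ v}, O u) (∀ u : {u // u ≠ v}, O u) ℂ)
      (fun u => x u) (fun u => y u) := by
    intro x y
    rw [Matrix.of_apply, piSplitAt_symm_restrict, piSplitAt_symm_restrict]
    by_cases hxy : x v = y v
    · rw [hM.2 x y c hxy, hxy, Matrix.one_apply_eq, one_mul]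
    · rw [hM.1 x y hxy, Matrix.one_apply_ne hxy, zero_mul]
  constructor
  · intro b a hba
    rw [heis_tensor_split e v hM', heis_one (he v), Matrix.one_apply_ne hba, zero_mul]
  · intro b a c' hba
    rw [heis_tensor_split e v hM', heis_tensor_split e v hM', heis_one (he v)]
    have : ∀ b : ∀ v, I v, (fun u : {u // u ≠ v} => Function.update b v c' u) =
        fun u : {u // u ≠ v} => b u := by
      intro b
      ext u
      simp [u.2]
    have h1 : (1 : Matrix (I v) (I v) ℂ) (Function.update b v c' v) (Function.update a v c' v) =
        (1 : Matrix (I v) (I v) ℂ) (b v) (a v) := by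
      rw [Function.update_self, Function.update_self, hba, Matrix.one_apply_eq,
        Matrix.one_apply_eq]
    rw [h1, this, this]

end Locality

/-! ### Averaging observables over a fixed state -/

section PartialTrace

variable {W K : Type*} [Fintype W] [DecidableEq W] [Fintype K]

/-- The partial trace over `K` of `F`, weighted with the state `κ`. -/
def condExp (κ : Matrix K K ℂ) (F : Matrix (W × K) (W × K) ℂ) : Matrix W W ℂ :=
  heis (fun w w' : W => Matrix.single w w' (1 : ℂ) ⊗ₖ κ) F

theorem condExp_apply (κ : Matrix K K ℂ) (F : Matrix (W × K) (W × K) ℂ) (w w' : W) :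
    condExp κ F w w' = ∑ k, ∑ k', κ k k' * F (w, k') (w', k) := by
  rw [condExp, heis_apply]
  simp only [Fintype.sum_prod_type, Matrix.kroneckerMap_apply, Matrix.single_apply]
  rw [Finset.sum_eq_single w' (by intro b _ hb; simp [hb.symm]) (by simp)]
  refine Finset.sum_congr rfl fun k _ => ?_
  rw [Finset.sum_eq_single w (by intro b _ hb; simp [hb.symm]) (by simp)]
  simp

/-- Averaging over `κ` is dual to the channel `X ↦ X ⊗ κ`, so operator bounds pass to the average by
`IsContr.heis`. -/
theorem IsChoi.condExp {κ : Matrix K K ℂ} (hκ : IsDensity κ) :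
    IsChoi fun w w' : W => Matrix.single w w' (1 : ℂ) ⊗ₖ κ := by
  refine ⟨?_, fun a b => ?_⟩
  · exact (posSemidef_kronecker (IsChoi.id (O := W)).posSemidef hκ.1).submatrix
      (fun p : W × W × K => ((p.1, p.2.1), p.2.2))
  · rw [Matrix.trace_kronecker, hκ.2, (IsChoi.id (O := W)).trace_eq, mul_one]

theorem trace_mul_kronecker_condExp {a : Type*} [Fintype a] (ω : Matrix (a × W) (a × W) ℂ)
    (κ : Matrix K K ℂ) (α : Matrix a a ℂ) (F : Matrix (W × K) (W × K) ℂ) :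
    (ω * (α ⊗ₖ condExp κ F)).trace = ((Matrix.of fun p q : a × W × K =>
      ω (p.1, p.2.1) (q.1, q.2.1) * κ p.2.2 q.2.2) * (α ⊗ₖ F)).trace := by
  simp only [Matrix.trace, Matrix.diag, Matrix.mul_apply, Fintype.sum_prod_type,
    Matrix.kroneckerMap_apply, Matrix.of_apply, condExp_apply]
  refine Finset.sum_congr rfl fun x _ => Finset.sum_congr rfl fun w _ => ?_
  conv_rhs => rw [Finset.sum_comm]
  refine Finset.sum_congr rfl fun x' _ => ?_
  conv_rhs => rw [Finset.sum_comm]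
  refine Finset.sum_congr rfl fun w' _ => ?_
  simp only [Finset.mul_sum]
  exact Finset.sum_congr rfl fun k _ => Finset.sum_congr rfl fun k' _ => by ring

end PartialTrace

/-! ### The anticommutation bound -/

section Anticommuting

/-- Without spectral theory: `(1 - F)(1 + F)(1 - F) + (1 + F)(1 - F)(1 + F) = 2 (1 - F²)`, and both
summands are congruences of positive matrices. -/
theorem IsContr.one_sub_sq {n : Type*} [Fintype n] [DecidableEq n] {F : Matrix n n ℂ}
    (h : IsContr F) : (1 - F * F).PosSemidef := by
  have hF := h.isHermitian
  have h1 := h.2.conjTranspose_mul_mul_same (1 - F)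
  have h2 := h.1.conjTranspose_mul_mul_same (1 + F)
  have := (h1.add h2).smul (a := (1 / 2 : ℂ)) (by norm_num [Complex.nonneg_iff])
  convert this using 1
  rw [Matrix.conjTranspose_sub, Matrix.conjTranspose_add, Matrix.conjTranspose_one, hF.eq]
  have : (1 - F) * (1 + F) * (1 - F) + (1 + F) * (1 - F) * (1 + F) = (2 : ℂ) • (1 - F * F) := by
    rw [two_smul]; noncomm_ring
  rw [this, smul_smul]
  norm_num

variable {o W : Type*} [Fintype o] [DecidableEq o] [Fintype W] [DecidableEq W]

/-- The matrix equals `(1 - G)² + ∑ c i² (1 - T i²)`: the cross terms of `G²` cancel in pairs,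
leaving `∑ c i² T i²`. -/
theorem posSemidef_of_anticommute {n : Type*} [Fintype n] [DecidableEq n]
    {T : Fin 3 → Matrix n n ℂ} (hT : ∀ i, (T i).IsHermitian)
    (hsq : ∀ i, (1 - T i * T i).PosSemidef) (hanti : ∀ i j, i ≠ j → T i * T j = -(T j * T i))
    (c : Fin 3 → ℝ) :
    (((1 + ∑ i, c i ^ 2 : ℝ) : ℂ) • (1 : Matrix n n ℂ)
      - (2 : ℂ) • ∑ i, (c i : ℂ) • T i).PosSemidef := by
  set G := ∑ i, (c i : ℂ) • T i with hG
  have hGG : G * G = ∑ i, ((c i : ℂ) ^ 2) • (T i * T i) := by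
    simp only [hG, Fin.sum_univ_three, add_mul, mul_add, Matrix.smul_mul, Matrix.mul_smul,
      smul_smul, hanti 1 0 (by decide), hanti 2 0 (by decide), hanti 2 1 (by decide)]
    module
  have hGh : G.conjTranspose = G := by
    simp [hG, Matrix.conjTranspose_sum, Matrix.conjTranspose_smul, (hT _).eq]
  have h1 := Matrix.posSemidef_conjTranspose_mul_self (1 - G)
  have h2 : (∑ i, ((c i : ℂ) ^ 2) • (1 - T i * T i)).PosSemidef := by
    refine Matrix.posSemidef_sum _ fun i _ => (hsq i).smul ?_
    exact_mod_cast sq_nonneg (c i)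
  convert h1.add h2 using 1
  rw [Matrix.conjTranspose_sub, Matrix.conjTranspose_one, hGh]
  have : (1 - G) * (1 - G) = 1 - (2 : ℂ) • G + G * G := by
    rw [two_smul]; noncomm_ring
  rw [this, hGG]
  simp only [Fin.sum_univ_three]
  push_cast
  module

omit [DecidableEq o] [DecidableEq W] in
theorem kronecker_anticommute {σ : Fin 3 → Matrix o o ℂ}
    (hanti : ∀ i j, i ≠ j → σ i * σ j = -(σ j * σ i)) {F : Fin 3 → Matrix W W ℂ}
    (hcomm : ∀ i j, i ≠ j → F i * F j = F j * F i) (i j : Fin 3) (hij : i ≠ j) :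
    (σ i ⊗ₖ F i) * (σ j ⊗ₖ F j) = -((σ j ⊗ₖ F j) * (σ i ⊗ₖ F i)) := by
  rw [← Matrix.mul_kronecker_mul, ← Matrix.mul_kronecker_mul, hanti i j hij, hcomm i j hij]
  ext; simp

/-- The pulled-back observables `heis e (σ i)` need not anticommute. The operator inequality is
therefore proved at the output of the channel, with the `σ i`, and then transported by the positive
unital dual of the channel tensored with the identity. -/
theorem steering_bound {a : Type*} [Fintype a] [DecidableEq a] {e : a → a → Matrix o o ℂ}
    (he : IsChoi e) {σ : Fin 3 → Matrix o o ℂ} (hσ : ∀ i, (σ i).IsHermitian)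
    (hsq : ∀ i, σ i * σ i = 1) (hanti : ∀ i j, i ≠ j → σ i * σ j = -(σ j * σ i))
    {F : Fin 3 → Matrix W W ℂ} (hF : ∀ i, IsContr (F i))
    (hcomm : ∀ i j, i ≠ j → F i * F j = F j * F i) {ω : Matrix (a × W) (a × W) ℂ}
    (hω : IsDensity ω) (c : Fin 3 → ℝ) :
    2 * ∑ i, c i * (ω * (heis e (σ i) ⊗ₖ F i)).trace.re ≤ 1 + ∑ i, c i ^ 2 := by
  have h1 := posSemidef_of_anticommute (T := fun i => σ i ⊗ₖ F i) (c := c)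
    (fun i => by
      rw [Matrix.IsHermitian, Matrix.conjTranspose_kronecker, (hσ i).eq, (hF i).isHermitian.eq])
    (fun i => by
      rw [← Matrix.mul_kronecker_mul, hsq, ← Matrix.one_kronecker_one]
      have := posSemidef_kronecker (Matrix.PosSemidef.one (n := o) (R := ℂ)) (hF i).one_sub_sq
      convert this using 1
      ext p q
      simp only [Matrix.sub_apply, Matrix.kroneckerMap_apply, mul_sub])
    (kronecker_anticommute hanti hcomm)
  have h2 := trace_mul_nonneg hω.1 (heis_posSemidef (he.kron IsChoi.id) h1)
  rw [heis_sub, heis_smul, heis_smul, heis_one (he.kron IsChoi.id), heis_sum] at h2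
  have hk : ∀ i, heis (fun p q : a × W => e p.1 q.1 ⊗ₖ Matrix.single p.2 q.2 (1 : ℂ))
      (σ i ⊗ₖ F i) = heis e (σ i) ⊗ₖ F i := fun i => by
    rw [heis_kron e (fun p q : W => Matrix.single p q (1 : ℂ)), heis_id]
  simp only [heis_smul, hk] at h2
  have h3 := (Complex.nonneg_iff.1 h2).1
  simp only [mul_sub, Matrix.mul_smul, mul_one, Matrix.trace_sub, Matrix.trace_smul, hω.2,
    Finset.mul_sum, Matrix.trace_sum, smul_eq_mul, Complex.sub_re, Complex.re_sum,
    Complex.ofReal_re] at h3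
  have hre : ∀ (r : ℝ) (z : ℂ), (2 * (r * z)).re = 2 * (r * z.re) := by simp
  simp only [hre] at h3
  rw [Finset.mul_sum]
  linarith

end Anticommuting

/-! ### Local observables and Pauli matrices -/

section Observables

variable {V : Type*} [Fintype V] [DecidableEq V] {d : V → ℕ}

theorem onQubit_eq_submatrix (v : V) (hv : d v = 2) (M : Matrix (Fin 2) (Fin 2) ℂ) :
    onQubit (d := d) v hv M = ((M.submatrix (Fin.cast hv) (Fin.cast hv)) ⊗ₖ
      (1 : Matrix (∀ u : {u // u ≠ v}, Fin (d u)) (∀ u : {u // u ≠ v}, Fin (d u)) ℂ)).submatrix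
        (Equiv.piSplitAt v fun u => Fin (d u)) (Equiv.piSplitAt v fun u => Fin (d u)) := by
  ext x y
  simp [onQubit, Equiv.piSplitAt, Matrix.one_apply, funext_iff]

theorem onQubit_mul_self (v : V) (hv : d v = 2) {M : Matrix (Fin 2) (Fin 2) ℂ} (hM : M * M = 1) :
    onQubit (d := d) v hv M * onQubit v hv M = 1 := by
  have h2 : (M.submatrix (Fin.cast hv) (Fin.cast hv)) * (M.submatrix (Fin.cast hv) (Fin.cast hv))
      = 1 := by
    have := Matrix.submatrix_mul_equiv M M (Fin.cast hv) (finCongr hv) (Fin.cast hv)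
    rw [hM] at this
    refine this.trans ?_
    exact Matrix.submatrix_one (Fin.cast hv) (finCongr hv).injective
  rw [onQubit_eq_submatrix, Matrix.submatrix_mul_equiv, ← Matrix.mul_kronecker_mul, h2, one_mul,
    Matrix.one_kronecker_one, Matrix.submatrix_one_equiv]

theorem isHermitian_onQubit (v : V) (hv : d v = 2) {M : Matrix (Fin 2) (Fin 2) ℂ}
    (hM : M.IsHermitian) : (onQubit (d := d) v hv M).IsHermitian := by
  rw [onQubit_eq_submatrix, Matrix.IsHermitian, Matrix.conjTranspose_submatrix,
    Matrix.conjTranspose_kronecker, Matrix.conjTranspose_submatrix, hM.eq,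
    Matrix.conjTranspose_one]

theorem idAt_onQubit (v : V) (hv : d v = 2) (M : Matrix (Fin 2) (Fin 2) ℂ) {w : V} (hw : w ≠ v) :
    IdAt w (onQubit (d := d) v hv M) := by
  constructor
  · intro x y hxy
    exact if_neg fun h => hxy (h w hw)
  · intro x y c hxy
    have : (∀ u, u ≠ v → Function.update x w c u = Function.update y w c u) ↔
        ∀ u, u ≠ v → x u = y u := by
      refine forall₂_congr fun u _ => ?_
      by_cases hu : u = w
      · subst hu; simp [hxy]
      · simp [hu]
    simp only [onQubit, Matrix.of_apply, this, Function.update_of_ne hw.symm]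

theorem idAt_onSet (R : Finset V)
    (P : Matrix (∀ v : {v // v ∈ R}, Fin (d v.1)) (∀ v : {v // v ∈ R}, Fin (d v.1)) ℂ) {w : V}
    (hw : w ∉ R) : IdAt w (onSet R P) := by
  constructor
  · intro x y hxy
    exact if_neg fun h => hxy (h w hw)
  · intro x y c hxy
    have h1 : (∀ u, u ∉ R → Function.update x w c u = Function.update y w c u) ↔
        ∀ u, u ∉ R → x u = y u := by
      refine forall₂_congr fun u _ => ?_
      by_cases hu : u = w
      · subst hu; simp [hxy]
      · simp [hu]
    have h2 : ∀ x : ∀ v, Fin (d v), (fun u : {v // v ∈ R} => Function.update x w c u) =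
        fun u : {v // v ∈ R} => x u := by
      intro x
      ext u
      have : u.1 ≠ w := by rintro rfl; exact hw u.2
      simp [this]
    simp only [onSet, Matrix.of_apply, h1, h2]

theorem isContr_onSet (R : Finset V)
    {P : Matrix (∀ v : {v // v ∈ R}, Fin (d v.1)) (∀ v : {v // v ∈ R}, Fin (d v.1)) ℂ}
    (hP : IsContr P) : IsContr (onSet R P) := by
  have key : ∀ Q : Matrix (∀ v : {v // v ∈ R}, Fin (d v.1)) (∀ v : {v // v ∈ R}, Fin (d v.1)) ℂ,
      onSet R Q = (Q ⊗ₖ (1 : Matrix (∀ v : {v // v ∉ R}, Fin (d v.1))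
        (∀ v : {v // v ∉ R}, Fin (d v.1)) ℂ)).submatrix
        (fun x => (fun v => x v, fun v => x v)) (fun x => (fun v => x v, fun v => x v)) := by
    intro Q
    ext x y
    simp [onSet, Matrix.one_apply, funext_iff]
  have hpos : ∀ Q : Matrix (∀ v : {v // v ∈ R}, Fin (d v.1)) (∀ v : {v // v ∈ R}, Fin (d v.1)) ℂ,
      Q.PosSemidef → (onSet R Q).PosSemidef := by
    intro Q hQ
    rw [key]
    exact (posSemidef_kronecker hQ Matrix.PosSemidef.one).submatrix _
  have hone : onSet R 1 = (1 : Matrix (∀ v, Fin (d v)) (∀ v, Fin (d v)) ℂ) := by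
    ext x y
    simp only [onSet, Matrix.of_apply, Matrix.one_apply, ← ite_and, funext_iff, Subtype.forall]
    congr 1
    exact propext ⟨fun h v => if hv : v ∈ R then h.2 v hv else h.1 v hv,
      fun h => ⟨fun v _ => h v, fun v _ => h v⟩⟩
  constructor
  · have : 1 - onSet R P = onSet R (1 - P) := by
      rw [← hone]; ext x y; simp only [onSet, Matrix.of_apply, Matrix.sub_apply]; split_ifs <;> simp
    rw [this]; exact hpos _ hP.1
  · have : 1 + onSet R P = onSet R (1 + P) := by
      rw [← hone]; ext x y; simp only [onSet, Matrix.of_apply, Matrix.add_apply]; split_ifs <;> simp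
    rw [this]; exact hpos _ hP.2

/-- On the eigenspaces `M = ±1` the product is `±N`. Algebraically, `1 - M N` is a quarter of `(1 +
M)(1 - N)(1 + M) + (1 - M)(1 + N)(1 - M)`, and `1 + M N` is obtained by flipping the sign of `N`. -/
theorem IsContr.mul_of_commute {n : Type*} [Fintype n] [DecidableEq n] {M N : Matrix n n ℂ}
    (hM : M.IsHermitian) (hsq : M * M = 1) (hN : IsContr N) (hcomm : M * N = N * M) :
    IsContr (M * N) := by
  have h1 := hN.1.conjTranspose_mul_mul_same (1 + M)
  have h2 := hN.2.conjTranspose_mul_mul_same (1 - M)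
  have h3 := hN.2.conjTranspose_mul_mul_same (1 + M)
  have h4 := hN.1.conjTranspose_mul_mul_same (1 - M)
  rw [Matrix.conjTranspose_add, Matrix.conjTranspose_one, hM.eq] at h1 h3
  rw [Matrix.conjTranspose_sub, Matrix.conjTranspose_one, hM.eq] at h2 h4
  have hMN : M * N * M = N := by rw [hcomm, mul_assoc, hsq, mul_one]
  constructor
  · have := (h1.add h2).smul (a := (1 / 4 : ℂ)) (by norm_num [Complex.nonneg_iff])
    convert this using 1
    have : (1 + M) * (1 - N) * (1 + M) + (1 - M) * (1 + N) * (1 - M) =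
        (2 : ℂ) • (1 + M * M - M * N - N * M) := by
      rw [two_smul]; noncomm_ring
    rw [this, smul_smul, hsq, ← hcomm]
    module
  · have := (h3.add h4).smul (a := (1 / 4 : ℂ)) (by norm_num [Complex.nonneg_iff])
    convert this using 1
    have : (1 + M) * (1 + N) * (1 + M) + (1 - M) * (1 - N) * (1 - M) =
        (2 : ℂ) • (1 + M * M + M * N + N * M) := by
      rw [two_smul]; noncomm_ring
    rw [this, smul_smul, hsq, ← hcomm]
    module

theorem onQubit_mul_apply (v : V) (hv : d v = 2) (M : Matrix (Fin 2) (Fin 2) ℂ)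
    {N : Matrix (∀ v, Fin (d v)) (∀ v, Fin (d v)) ℂ} (hN : IdAt v N) (x y : ∀ v, Fin (d v)) :
    (onQubit v hv M * N) x y =
      M (Fin.cast hv (x v)) (Fin.cast hv (y v)) * N (Function.update x v (y v)) y := by
  rw [Matrix.mul_apply, Finset.sum_eq_single (Function.update x v (y v))]
  · have : ∀ w, w ≠ v → x w = Function.update x v (y v) w := fun w hw => by simp [hw]
    simp only [onQubit, Matrix.of_apply, if_pos this, Function.update_self]
  · intro z _ hz
    obtain ⟨w, hw⟩ := Function.ne_iff.1 hz
    by_cases hwv : w = v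
    · subst hwv
      rw [hN.1 z y (by simpa using hw), mul_zero]
    · rw [(idAt_onQubit v hv M hwv).1 x z (by simpa [hwv] using hw.symm), zero_mul]
  · simp

theorem idAt_onQubit_mul (v : V) (hv : d v = 2) (M : Matrix (Fin 2) (Fin 2) ℂ)
    {N : Matrix (∀ v, Fin (d v)) (∀ v, Fin (d v)) ℂ} (hN : IdAt v N) {w : V} (hw : w ≠ v)
    (hNw : IdAt w N) : IdAt w (onQubit v hv M * N) := by
  constructor
  · intro x y hxy
    rw [onQubit_mul_apply v hv M hN, hNw.1 _ _ (by simpa [hw] using hxy), mul_zero]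
  · intro x y c hxy
    have hc : Function.update (Function.update x w c) v (y v) =
        Function.update (Function.update x v (y v)) w c := Function.update_comm hw c (y v) x
    rw [onQubit_mul_apply v hv M hN, onQubit_mul_apply v hv M hN, Function.update_of_ne hw.symm,
      Function.update_of_ne hw.symm, hc,
      hNw.2 _ _ _ (by simpa [hw] using hxy)]

/-- Splitting off a qubit factor from an observable. -/
theorem exists_split_onQubit (A : V) (hA : d A = 2) (σ : Matrix (Fin 2) (Fin 2) ℂ)
    {Q : Matrix (∀ v, Fin (d v)) (∀ v, Fin (d v)) ℂ} (hQ : IsContr Q) (hQA : IdAt A Q) :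
    ∃ N : Matrix (∀ u : {u // u ≠ A}, Fin (d u)) (∀ u : {u // u ≠ A}, Fin (d u)) ℂ,
      IsContr N ∧ (∀ u : {u // u ≠ A}, IdAt u.1 Q → IdAt u N) ∧
      ∀ x y, (onQubit A hA σ * Q) x y =
        σ.submatrix (Fin.cast hA) (Fin.cast hA) (x A) (y A) *
          N (fun u => x u) (fun u => y u) := by
  -- An arbitrary reference level of `A`; since `Q` is trivial at `A`, restricting to it loses
  -- nothing.
  let c : Fin (d A) := Fin.cast hA.symm 0
  let ext : (∀ u : {u // u ≠ A}, Fin (d u)) → ∀ v, Fin (d v) :=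
    fun m => (Equiv.piSplitAt A fun v => Fin (d v)).symm (c, m)
  have hext : Function.Injective ext := fun m n h =>
    congrArg Prod.snd ((Equiv.piSplitAt A fun v => Fin (d v)).symm.injective h)
  have hu : ∀ m (u : {u // u ≠ A}), ext m u = m u := by
    intro m u
    simp [ext, Equiv.piSplitAt, u.2]
  refine ⟨Q.submatrix ext ext, hQ.submatrix hext, fun u h => ⟨fun x y hxy => ?_,
    fun x y c' hxy => ?_⟩, fun x y => ?_⟩
  · exact h.1 _ _ (by rwa [hu, hu])
  · have := h.2 (ext x) (ext y) c' (by rwa [hu, hu])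
    rw [Matrix.submatrix_apply, Matrix.submatrix_apply, ← this]
    simp only [ext, piSplitAt_symm_update]
  · rw [onQubit_mul_apply A hA σ hQA, Matrix.submatrix_apply, Matrix.submatrix_apply]
    have := hQA.2 (Function.update x A (y A)) y c (by simp)
    rw [Function.update_idem] at this
    rw [← this]
    simp only [ext, piSplitAt_symm_restrict (I := fun v => Fin (d v)) A c]

/-- The Pauli matrices. -/
def pauli : Fin 3 → Matrix (Fin 2) (Fin 2) ℂ := ![pauliX, pauliY, pauliZ]

theorem isHermitian_pauli (i : Fin 3) : (pauli i).IsHermitian := by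
  ext a b
  fin_cases i <;> fin_cases a <;> fin_cases b <;> simp [pauli, pauliX, pauliY, pauliZ]

theorem pauli_mul_self (i : Fin 3) : pauli i * pauli i = 1 := by
  ext a b
  fin_cases i <;> fin_cases a <;> fin_cases b <;> simp [pauli, pauliX, pauliY, pauliZ]

theorem pauli_anticommute (i j : Fin 3) (hij : i ≠ j) :
    pauli i * pauli j = -(pauli j * pauli i) := by
  ext a b
  fin_cases i <;> fin_cases j <;> first
    | exact absurd rfl hij
    | fin_cases a <;> fin_cases b <;> simp [pauli, pauliX, pauliY, pauliZ]

end Observables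

/-! ### Splitting each party's inputs into two groups -/

section Regrouping

/-- A pair of partial configurations, off and on the predicate `p`, is a full configuration. -/
def gluePi {U : Type*} {T : U → Type*} {Z : ∀ u, T u → Type*} (p : ∀ u, T u → Prop)
    [∀ u, DecidablePred (p u)] :
    ((∀ u (t : {t // ¬ p u t}), Z u t) × (∀ u (t : {t // p u t}), Z u t)) ≃ ∀ u t, Z u t where
  toFun x u t := if h : p u t then x.2 u ⟨t, h⟩ else x.1 u ⟨t, h⟩
  invFun z := (fun u t => z u t, fun u t => z u t)
  left_inv x := by
    ext u t
    · simp [t.2]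
    · simp [t.2]
  right_inv z := by
    ext u t
    simp

variable {U : Type*} [DecidableEq U] {T : U → Type*} {Z : ∀ u, T u → Type*} {p : ∀ u, T u → Prop}
  [∀ u, DecidablePred (p u)]

omit [DecidableEq U] in
theorem gluePi_apply_of_pos (w : ∀ u (t : {t // ¬ p u t}), Z u t)
    (k : ∀ u (t : {t // p u t}), Z u t) {u : U} {t : T u} (h : p u t) :
    gluePi p (w, k) u t = k u ⟨t, h⟩ := dif_pos h

omit [DecidableEq U] in
theorem gluePi_apply_of_neg (w : ∀ u (t : {t // ¬ p u t}), Z u t)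
    (k : ∀ u (t : {t // p u t}), Z u t) {u : U} {t : T u} (h : ¬ p u t) :
    gluePi p (w, k) u t = w u ⟨t, h⟩ := dif_neg h

theorem gluePi_update (w : ∀ u (t : {t // ¬ p u t}), Z u t) (k : ∀ u (t : {t // p u t}), Z u t)
    (u : U) (c : ∀ t : {t // ¬ p u t}, Z u t) :
    gluePi p (Function.update w u c, k) = Function.update (gluePi p (w, k)) u
      (fun t => if h : p u t then k u ⟨t, h⟩ else c ⟨t, h⟩) := by
  ext v t
  by_cases hv : v = u
  · subst hv; simp [gluePi]
  · simp [gluePi, hv]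

/-- Here `κ` may be correlated between parties. Triviality at `u` still survives, because `F` is the
identity on both groups of inputs of `u`. -/
theorem IdAt.condExp_gluePi [Fintype U] [∀ u, Fintype (T u)] [∀ u, DecidableEq (T u)]
    [∀ u t, Fintype (Z u t)] [DecidableEq (∀ u (t : {t // ¬ p u t}), Z u t)]
    (κ : Matrix (∀ u (t : {t // p u t}), Z u t) (∀ u (t : {t // p u t}), Z u t) ℂ)
    {F : Matrix (∀ u t, Z u t) (∀ u t, Z u t) ℂ} {u : U} (hF : IdAt u F) :
    IdAt u (condExp κ (F.submatrix (gluePi p) (gluePi p))) := by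
  constructor
  · intro w w' hw
    rw [condExp_apply]
    refine Finset.sum_eq_zero fun k _ => Finset.sum_eq_zero fun k' _ => ?_
    rw [Matrix.submatrix_apply, hF.1, mul_zero]
    intro h
    refine hw (funext fun t => ?_)
    have := congrFun h t
    rwa [gluePi_apply_of_neg _ _ t.2, gluePi_apply_of_neg _ _ t.2] at this
  · intro w w' c hw
    rw [condExp_apply, condExp_apply]
    refine Finset.sum_congr rfl fun k _ => Finset.sum_congr rfl fun k' _ => ?_
    rw [Matrix.submatrix_apply, Matrix.submatrix_apply]
    congr 1
    -- If the averaged inputs of `u` differ, both entries of `F` vanish; otherwise updating the kept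
    -- inputs of `u` changes the two arguments of `F` alike.
    by_cases hk : k u = k' u
    · rw [gluePi_update, gluePi_update, hk, hF.2]
      ext t
      by_cases h : p u t
      · rw [gluePi_apply_of_pos _ _ h, gluePi_apply_of_pos _ _ h, hk]
      · rw [gluePi_apply_of_neg _ _ h, gluePi_apply_of_neg _ _ h, hw]
    · obtain ⟨t, ht⟩ := Function.ne_iff.1 hk
      rw [hF.1, hF.1]
      · intro h
        have := congrFun h t
        rw [gluePi_apply_of_pos _ _ t.2, gluePi_apply_of_pos _ _ t.2] at this
        exact ht this.symm
      · intro h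
        have := congrFun h t
        rw [gluePi_apply_of_pos _ _ t.2, gluePi_apply_of_pos _ _ t.2] at this
        exact ht this.symm

theorem IdAt.of_subsingleton {V : Type*} [DecidableEq V] {I : V → Type*} {v : V}
    [Subsingleton (I v)] (M : Matrix (∀ v, I v) (∀ v, I v) ℂ) : IdAt v M := by
  refine ⟨fun x y h => absurd (Subsingleton.elim _ _) h, fun x y c _ => ?_⟩
  rw [Subsingleton.elim c (x v), Function.update_eq_self, Subsingleton.elim (x v) (y v),
    Function.update_eq_self]

end Regrouping

/-! ### Factorization of the joint source state -/

section Sources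

variable {V S : Type*} [Fintype V] [DecidableEq V] [Fintype S] [DecidableEq S]
  {parties : S → Finset V} {D : S → V → ℕ}

/-- Up to reindexing systems by source rather than by receiver, this is an ordinary tensor product
of densities. -/
theorem IsDensity.jointSource
    {τ : ∀ s, Matrix (∀ v : {v // v ∈ parties s}, Fin (D s v.1))
      (∀ v : {v // v ∈ parties s}, Fin (D s v.1)) ℂ} (hτ : ∀ s, IsDensity (τ s)) :
    IsDensity (jointSource parties D τ) := by
  let ε : (∀ v, InputIndex parties D v) ≃ ∀ s, ∀ v : {v // v ∈ parties s}, Fin (D s v.1) :=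
    { toFun := fun x s v => x v.1 ⟨s, v.2⟩
      invFun := fun z v s => z s.1 ⟨v, s.2⟩
      left_inv := fun _ => rfl
      right_inv := fun _ => rfl }
  have h := IsDensity.tensor hτ
  refine ⟨h.1.submatrix ε, ?_⟩
  rw [← h.2, Matrix.trace, Matrix.trace, ← ε.sum_comp]
  rfl

omit [Fintype V] [Fintype S] [DecidableEq S] in
/-- A source that is a product state, or does not reach both `A` and `C`, factorizes into a factor
on the systems of `A` (or everything, if `C` gets nothing) and a factor on the other systems. -/
theorem exists_source_factors (A C : V) {s : S}
    {τ : Matrix (∀ v : {v // v ∈ parties s}, Fin (D s v.1))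
      (∀ v : {v // v ∈ parties s}, Fin (D s v.1)) ℂ} (hτ : IsDensity τ)
    (hprod : A ∈ parties s → C ∈ parties s → ∃ ω : ∀ v : {v // v ∈ parties s},
      Matrix (Fin (D s v.1)) (Fin (D s v.1)) ℂ, (∀ v, IsDensity (ω v)) ∧ τ = tensor ω) :
    ∃ M N : Matrix (∀ v : {v // v ∈ parties s}, Fin (D s v.1))
      (∀ v : {v // v ∈ parties s}, Fin (D s v.1)) ℂ,
      M.PosSemidef ∧ N.PosSemidef ∧ (∀ x y, τ x y = M x y * N x y) ∧
      (∀ x x' y y', (∀ v : {v // v ∈ parties s}, (v.1 = A ∨ C ∉ parties s) →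
        x v = x' v ∧ y v = y' v) → M x y = M x' y') ∧
      (∀ x x' y y', (∀ v : {v // v ∈ parties s}, v.1 ≠ A → C ∈ parties s →
        x v = x' v ∧ y v = y' v) → N x y = N x' y') := by
  by_cases hC : C ∈ parties s
  · by_cases hA : A ∈ parties s
    · obtain ⟨ω, hω, rfl⟩ := hprod hA hC
      refine ⟨Matrix.of fun x y => ∏ v ∈ Finset.univ.filter fun v : {v // v ∈ parties s} => v.1 = A,
          ω v (x v) (y v),
        Matrix.of fun x y => ∏ v ∈ Finset.univ.filter fun v : {v // v ∈ parties s} => ¬ v.1 = A,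
          ω v (x v) (y v), ?_, ?_, fun x y => ?_, fun x x' y y' h => ?_, fun x x' y y' h => ?_⟩
      · exact posSemidef_hadamardProd _ (fun v => (ω v).submatrix
          (fun x : ∀ v : {v // v ∈ parties s}, Fin (D s v.1) => x v) (fun x => x v))
          fun v _ => (hω v).1.submatrix _
      · exact posSemidef_hadamardProd _ (fun v => (ω v).submatrix
          (fun x : ∀ v : {v // v ∈ parties s}, Fin (D s v.1) => x v) (fun x => x v))
          fun v _ => (hω v).1.submatrix _
      · exact (Finset.prod_filter_mul_prod_filter_not _ _ _).symm
      · refine Finset.prod_congr rfl fun v hv => ?_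
        obtain ⟨h1, h2⟩ := h v (Or.inl (Finset.mem_filter.1 hv).2)
        rw [h1, h2]
      · refine Finset.prod_congr rfl fun v hv => ?_
        obtain ⟨h1, h2⟩ := h v (Finset.mem_filter.1 hv).2 hC
        rw [h1, h2]
    · refine ⟨Matrix.of fun _ _ => 1, τ, posSemidef_ones _, hτ.1, by simp, by simp,
        fun x x' y y' h => ?_⟩
      have h' := fun v : {v // v ∈ parties s} => h v (by rintro rfl; exact hA v.2) hC
      rw [funext fun v => (h' v).1, funext fun v => (h' v).2]
  · refine ⟨τ, Matrix.of fun _ _ => 1, hτ.1, posSemidef_ones _, by simp,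
      fun x x' y y' h => ?_, by simp⟩
    have h' := fun v : {v // v ∈ parties s} => h v (Or.inr hC)
    rw [funext fun v => (h' v).1, funext fun v => (h' v).2]

variable (parties D) in
/-- The index set of the systems that parties other than `A` receive from sources not reaching
`C`. -/
abbrev UnlinkedIndex (A C : V) : Type _ :=
  ∀ (u : {u // u ≠ A}) (s : {s : {s // u.1 ∈ parties s} // ¬ C ∈ parties s.1}), Fin (D s.1.1 u.1)

variable (parties D) in
/-- The index set of the systems that parties other than `A` receive from sources reaching `C`. -/
abbrev LinkedIndex (A C : V) : Type _ :=
  ∀ (u : {u // u ≠ A}) (s : {s : {s // u.1 ∈ parties s} // C ∈ parties s.1}), Fin (D s.1.1 u.1)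

variable (parties D) in
/-- The inputs of all parties, split into those of `A` and the two groups of inputs of the others. -/
def inputSplit (A C : V) :
    (InputIndex parties D A × UnlinkedIndex parties D A C × LinkedIndex parties D A C) ≃
      ∀ v, InputIndex parties D v :=
  ((Equiv.refl _).prodCongr (gluePi (U := {u // u ≠ A}) (T := fun u => {s // u.1 ∈ parties s})
    (Z := fun u s => Fin (D s.1 u.1)) fun _ s => C ∈ parties s.1)).trans
    (Equiv.piSplitAt A (InputIndex parties D)).symm

omit [Fintype V] [Fintype S] [DecidableEq S] in
theorem inputSplit_self (A C : V) (p) : inputSplit parties D A C p A = p.1 := by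
  simp [inputSplit, Equiv.piSplitAt]

omit [Fintype V] [Fintype S] [DecidableEq S] in
theorem inputSplit_of_ne (A C : V) (p) (u : {u // u ≠ A}) :
    inputSplit parties D A C p u = gluePi (U := {u // u ≠ A})
      (T := fun u => {s // u.1 ∈ parties s})
      (Z := fun u s => Fin (D s.1 u.1)) (fun _ s => C ∈ parties s.1) p.2 u := by
  simp [inputSplit, Equiv.piSplitAt, u.2]

omit [Fintype V] [Fintype S] [DecidableEq S] in
theorem inputSplit_unlinked (A C : V) (p) {v : V} (hv : v ≠ A) (s : {s // v ∈ parties s})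
    (hC : C ∉ parties s.1) : inputSplit parties D A C p v s = p.2.1 ⟨v, hv⟩ ⟨s, hC⟩ := by
  rw [inputSplit_of_ne A C p ⟨v, hv⟩]
  exact dif_neg hC

omit [Fintype V] [Fintype S] [DecidableEq S] in
theorem inputSplit_linked (A C : V) (p) {v : V} (hv : v ≠ A) (s : {s // v ∈ parties s})
    (hC : C ∈ parties s.1) : inputSplit parties D A C p v s = p.2.2 ⟨v, hv⟩ ⟨s, hC⟩ := by
  rw [inputSplit_of_ne A C p ⟨v, hv⟩]
  exact dif_pos hC

theorem isDensity_pair_of_product {m n : Type*} [Fintype m] [Fintype n] {M : Matrix m m ℂ}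
    {N : Matrix n n ℂ} (hM : M.PosSemidef) (hN : N.PosSemidef) (h : M.trace * N.trace = 1) :
    IsDensity (N.trace • M) ∧ IsDensity (M.trace • N) :=
  ⟨⟨hM.smul hN.trace_nonneg, by rw [Matrix.trace_smul, smul_eq_mul, mul_comm, h]⟩,
    hN.smul hM.trace_nonneg, by rw [Matrix.trace_smul, smul_eq_mul, h]⟩

/-- Multiplying the factors of the individual sources gives one product that ignores the linked
inputs and one that sees nothing else. Freezing the ignored coordinates at a reference configuration
`p₀` turns them into matrices on the two index sets. -/
theorem exists_jointSource_factors (A C : V)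
    {τ : ∀ s, Matrix (∀ v : {v // v ∈ parties s}, Fin (D s v.1))
      (∀ v : {v // v ∈ parties s}, Fin (D s v.1)) ℂ} (hτ : ∀ s, IsDensity (τ s))
    (hprod : ∀ s, A ∈ parties s → C ∈ parties s → ∃ ω : ∀ v : {v // v ∈ parties s},
      Matrix (Fin (D s v.1)) (Fin (D s v.1)) ℂ, (∀ v, IsDensity (ω v)) ∧ τ s = tensor ω) :
    ∃ ω κ, IsDensity ω ∧ IsDensity κ ∧
      (jointSource parties D τ).submatrix (inputSplit parties D A C) (inputSplit parties D A C) =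
        Matrix.of fun p q => ω (p.1, p.2.1) (q.1, q.2.1) * κ p.2.2 q.2.2 := by
  have hJ := IsDensity.jointSource hτ
  choose M N hM hN hMN hMdep hNdep using fun s => exists_source_factors A C (hτ s) (hprod s)
  -- A reference configuration exists because a matrix on an empty index set has trace zero, not
  -- one.
  obtain ⟨x₀⟩ : Nonempty (∀ v, InputIndex parties D v) := by
    by_contra h
    rw [not_nonempty_iff] at h
    have := hJ.2
    simp [Matrix.trace] at this
  let g := inputSplit parties D A C
  obtain ⟨p₀, rfl⟩ := g.surjective x₀
  let r : ∀ s, (∀ v, InputIndex parties D v) → ∀ v : {v // v ∈ parties s}, Fin (D s v.1) :=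
    fun s x v => x v.1 ⟨s, v.2⟩
  let f : InputIndex parties D A × UnlinkedIndex parties D A C → ∀ v, InputIndex parties D v :=
    fun a => g (a.1, a.2, p₀.2.2)
  let ω₀ := (Matrix.of fun x y => ∏ s, ((M s).submatrix (r s) (r s)) x y).submatrix f f
  let κ₀ := (Matrix.of fun x y => ∏ s, ((N s).submatrix (r s) (r s)) x y).submatrix
    (fun k => g (p₀.1, p₀.2.1, k)) (fun k => g (p₀.1, p₀.2.1, k))
  have hω₀ : ω₀.PosSemidef :=
    (posSemidef_hadamardProd _ _ fun s _ => (hM s).submatrix (r s)).submatrix _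
  have hκ₀ : κ₀.PosSemidef :=
    (posSemidef_hadamardProd _ _ fun s _ => (hN s).submatrix (r s)).submatrix _
  have hfac : ∀ p q, jointSource parties D τ (g p) (g q) =
      ω₀ (p.1, p.2.1) (q.1, q.2.1) * κ₀ p.2.2 q.2.2 := by
    intro p q
    simp only [jointSource, Matrix.of_apply, hMN, Finset.prod_mul_distrib]
    congr 1
    · refine Finset.prod_congr rfl fun s _ => hMdep s _ _ _ _ ?_
      have key : ∀ (p : InputIndex parties D A × UnlinkedIndex parties D A C ×
          LinkedIndex parties D A C) (v : {v // v ∈ parties s}),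
          v.1 = A ∨ C ∉ parties s → g p v.1 ⟨s, v.2⟩ = g (p.1, p.2.1, p₀.2.2) v.1 ⟨s, v.2⟩ := by
        rintro p ⟨v, hv⟩ h
        by_cases hvA : v = A
        · subst hvA
          simp only [g, inputSplit_self]
        · have hC := h.resolve_left hvA
          simp only [g]
          rw [inputSplit_unlinked A C _ hvA ⟨s, hv⟩ hC, inputSplit_unlinked A C _ hvA ⟨s, hv⟩ hC]
      exact fun v h => ⟨key p v h, key q v h⟩
    · refine Finset.prod_congr rfl fun s _ => hNdep s _ _ _ _ ?_
      have key : ∀ (p : InputIndex parties D A × UnlinkedIndex parties D A C ×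
          LinkedIndex parties D A C) (v : {v // v ∈ parties s}),
          v.1 ≠ A → C ∈ parties s → g p v.1 ⟨s, v.2⟩ = g (p₀.1, p₀.2.1, p.2.2) v.1 ⟨s, v.2⟩ := by
        rintro p ⟨v, hv⟩ hvA hC
        simp only [g]
        rw [inputSplit_linked A C _ hvA ⟨s, hv⟩ hC, inputSplit_linked A C _ hvA ⟨s, hv⟩ hC]
      exact fun v h hC => ⟨key p v h hC, key q v h hC⟩
  have htr : ω₀.trace * κ₀.trace = 1 := by
    rw [← hJ.2]
    simp only [Matrix.trace, Matrix.diag]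
    rw [← g.sum_comp, Fintype.sum_prod_type]
    simp only [hfac, Fintype.sum_prod_type, Finset.sum_mul]
    simp only [Finset.mul_sum]
  -- Scaling each factor by the trace of the other normalizes both; the product is unchanged because
  -- the two traces multiply to one.
  obtain ⟨h1, h2⟩ := isDensity_pair_of_product hω₀ hκ₀ htr
  refine ⟨_, _, h1, h2, ?_⟩
  ext p q
  rw [Matrix.submatrix_apply, hfac]
  simp only [Matrix.of_apply, Matrix.smul_apply, smul_eq_mul]
  linear_combination (-ω₀ (p.1, p.2.1) (q.1, q.2.1) * κ₀ p.2.2 q.2.2) * htr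

end Sources

/-! ### The bound for network states -/

section Network

variable {V S : Type*} [Fintype V] [DecidableEq V] [Fintype S] [DecidableEq S]
  {parties : S → Finset V} {D : S → V → ℕ} {d : V → ℕ}

omit [DecidableEq S] in
theorem trace_tensorMap_mul {I O : V → Type*} [∀ v, Fintype (I v)] [∀ v, DecidableEq (I v)]
    [∀ v, Fintype (O v)] (Φ : ∀ v, Matrix (I v) (I v) ℂ →ₗ[ℂ] Matrix (O v) (O v) ℂ)
    (X : Matrix (∀ v, I v) (∀ v, I v) ℂ) (M : Matrix (∀ v, O v) (∀ v, O v) ℂ) :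
    (tensorMap Φ X * M).trace = (X * heis (fun a b : ∀ v, I v =>
      tensor fun v => Φ v (Matrix.single (a v) (b v) 1)) M).trace := by
  simp only [tensorMap, Finset.sum_mul, Matrix.trace_sum, Matrix.smul_mul, Matrix.trace_smul]
  simp only [Matrix.trace, Matrix.diag, Matrix.mul_apply (M := X), heis, Matrix.of_apply, smul_eq_mul]

instance (A C : V) : DecidableEq (UnlinkedIndex parties D A C) :=
  fun _ _ => Fintype.decidablePiFintype _ _

instance (A C : V) : DecidableEq (LinkedIndex parties D A C) :=
  fun _ _ => Fintype.decidablePiFintype _ _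

/-- The Heisenberg dual of the channels of all parties but `A`. -/
def dualOff (A : V) (Φ : ∀ v, Matrix (InputIndex parties D v) (InputIndex parties D v) ℂ →ₗ[ℂ]
      Matrix (Fin (d v)) (Fin (d v)) ℂ)
    (N : Matrix (∀ u : {u // u ≠ A}, Fin (d u)) (∀ u : {u // u ≠ A}, Fin (d u)) ℂ) :
    Matrix (∀ u : {u // u ≠ A}, InputIndex parties D u.1)
      (∀ u : {u // u ≠ A}, InputIndex parties D u.1) ℂ :=
  heis (fun a b : ∀ u : {u // u ≠ A}, InputIndex parties D u.1 =>
    tensor fun u : {u // u ≠ A} => Φ u (Matrix.single (a u) (b u) 1)) N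

variable (parties D) in
/-- The inputs of the parties other than `A`, split by whether the source reaches `C`. -/
def offSplit (A C : V) : (UnlinkedIndex parties D A C × LinkedIndex parties D A C) ≃
    ∀ u : {u // u ≠ A}, InputIndex parties D u.1 :=
  gluePi (U := {u // u ≠ A}) (T := fun u => {s // u.1 ∈ parties s})
    (Z := fun u s => Fin (D s.1 u.1)) fun _ s => C ∈ parties s.1

/-- The effective observable of the parties other than `A` on the sources not reaching `C`, when
the other systems are in the state `κ`. -/
def effectiveObs (A C : V) (Φ : ∀ v, Matrix (InputIndex parties D v) (InputIndex parties D v) ℂ →ₗ[ℂ]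
      Matrix (Fin (d v)) (Fin (d v)) ℂ)
    (κ : Matrix (LinkedIndex parties D A C) (LinkedIndex parties D A C) ℂ)
    (N : Matrix (∀ u : {u // u ≠ A}, Fin (d u)) (∀ u : {u // u ≠ A}, Fin (d u)) ℂ) :
    Matrix (UnlinkedIndex parties D A C) (UnlinkedIndex parties D A C) ℂ :=
  condExp κ ((dualOff A Φ N).submatrix (offSplit parties D A C) (offSplit parties D A C))

section

variable {A C : V} {Φ : ∀ v, Matrix (InputIndex parties D v) (InputIndex parties D v) ℂ →ₗ[ℂ]
      Matrix (Fin (d v)) (Fin (d v)) ℂ} (hΦ : ∀ v, IsChannel (Φ v))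
  {κ : Matrix (LinkedIndex parties D A C) (LinkedIndex parties D A C) ℂ}
  {N : Matrix (∀ u : {u // u ≠ A}, Fin (d u)) (∀ u : {u // u ≠ A}, Fin (d u)) ℂ}

include hΦ

theorem isContr_effectiveObs (hκ : IsDensity κ) (hN : IsContr N) :
    IsContr (effectiveObs A C Φ κ N) := by
  have h1 : IsContr (dualOff A Φ N) := hN.heis (IsChoi.tensor fun u => IsChoi.of_channel (hΦ u.1))
  have h2 := h1.submatrix (offSplit parties D A C).injective
  exact IsContr.heis (IsChoi.condExp hκ) h2

theorem idAt_effectiveObs {u : {u // u ≠ A}} (hN : u.1 ≠ C → IdAt u N) :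
    IdAt u (effectiveObs A C Φ κ N) := by
  -- Every source feeding `C` reaches `C`, so `C` keeps no unlinked input: its factor is
  -- one-dimensional and any operator is trivial there.
  by_cases hu : u.1 = C
  · have : IsEmpty {s : {s // u.1 ∈ parties s} // ¬ C ∈ parties s.1} :=
      ⟨fun s => s.2 (hu ▸ s.1.2)⟩
    exact IdAt.of_subsingleton _
  · have h1 : IdAt u (dualOff A Φ N) :=
      IdAt.heis_tensor (fun u => IsChoi.of_channel (hΦ u.1)) (hN hu)
    exact IdAt.condExp_gluePi (U := {u // u ≠ A}) (T := fun u => {s // u.1 ∈ parties s})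
      (Z := fun u s => Fin (D s.1 u.1)) (p := fun _ s => C ∈ parties s.1) κ h1

end

theorem trace_submatrix_equiv {m n : Type*} [Fintype m] [Fintype n] (ε : m ≃ n)
    (M : Matrix n n ℂ) : (M.submatrix ε ε).trace = M.trace :=
  ε.sum_comp fun x => M x x

/-- The expectation value of an observable that splits into an observable of `A` and one of the
other parties, as that of an effective observable on the sources not reaching `C`. -/
theorem trace_tensorMap_jointSource_mul (A C : V)
    {τ : ∀ s, Matrix (∀ v : {v // v ∈ parties s}, Fin (D s v.1))
      (∀ v : {v // v ∈ parties s}, Fin (D s v.1)) ℂ}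
    (Φ : ∀ v, Matrix (InputIndex parties D v) (InputIndex parties D v) ℂ →ₗ[ℂ]
      Matrix (Fin (d v)) (Fin (d v)) ℂ) {ω κ}
    (hJ : (jointSource parties D τ).submatrix (inputSplit parties D A C)
      (inputSplit parties D A C) =
        Matrix.of fun p q => ω (p.1, p.2.1) (q.1, q.2.1) * κ p.2.2 q.2.2)
    {M : Matrix (∀ v, Fin (d v)) (∀ v, Fin (d v)) ℂ} {P : Matrix (Fin (d A)) (Fin (d A)) ℂ}
    {N : Matrix (∀ u : {u // u ≠ A}, Fin (d u)) (∀ u : {u // u ≠ A}, Fin (d u)) ℂ}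
    (hM : ∀ x y, M x y = P (x A) (y A) * N (fun u => x u) (fun u => y u)) :
    (tensorMap Φ (jointSource parties D τ) * M).trace =
      (ω * (heis (fun a b => Φ A (Matrix.single a b 1)) P ⊗ₖ effectiveObs A C Φ κ N)).trace := by
  rw [effectiveObs, trace_mul_kronecker_condExp, ← hJ, trace_tensorMap_mul]
  have hH : (heis (fun a b : ∀ v, InputIndex parties D v => tensor fun v =>
      Φ v (Matrix.single (a v) (b v) 1)) M).submatrix (inputSplit parties D A C)
        (inputSplit parties D A C) =
      heis (fun a b => Φ A (Matrix.single a b 1)) P ⊗ₖ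
        (dualOff A Φ N).submatrix (offSplit parties D A C) (offSplit parties D A C) := by
    ext p q
    rw [Matrix.submatrix_apply, heis_tensor_split (fun v a b => Φ v (Matrix.single a b 1)) A hM,
      inputSplit_self, inputSplit_self, Matrix.kroneckerMap_apply, Matrix.submatrix_apply,
      dualOff]
    congr 2
    · ext1 u; exact inputSplit_of_ne A C p u
    · ext1 u; exact inputSplit_of_ne A C q u
  rw [← hH, Matrix.submatrix_mul_equiv]
  exact (trace_submatrix_equiv (inputSplit parties D A C) _).symm

/-- The inequality for a fixed value of the shared randomness, when all sources reaching both `A`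
and `C` emit product states. -/
theorem product_network_bound (A C : V) (hA : d A = 2)
    {τ : ∀ s, Matrix (∀ v : {v // v ∈ parties s}, Fin (D s v.1))
      (∀ v : {v // v ∈ parties s}, Fin (D s v.1)) ℂ} (hτ : ∀ s, IsDensity (τ s))
    (hprod : ∀ s, A ∈ parties s → C ∈ parties s → ∃ ω : ∀ v : {v // v ∈ parties s},
      Matrix (Fin (D s v.1)) (Fin (D s v.1)) ℂ, (∀ v, IsDensity (ω v)) ∧ τ s = tensor ω)
    {Φ : ∀ v, Matrix (InputIndex parties D v) (InputIndex parties D v) ℂ →ₗ[ℂ]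
      Matrix (Fin (d v)) (Fin (d v)) ℂ} (hΦ : ∀ v, IsChannel (Φ v))
    {Q : Fin 3 → Matrix (∀ v, Fin (d v)) (∀ v, Fin (d v)) ℂ} (hQ : ∀ i, IsContr (Q i))
    (hQA : ∀ i, IdAt A (Q i))
    (hQdisj : ∀ i j, i ≠ j → ∀ w, w ≠ C → IdAt w (Q i) ∨ IdAt w (Q j)) (c : Fin 3 → ℝ) :
    2 * ∑ i, c i * (tensorMap Φ (jointSource parties D τ) *
      (onQubit A hA (pauli i) * Q i)).trace.re ≤ 1 + ∑ i, c i ^ 2 := by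
  obtain ⟨ω, κ, hω, hκ, hJ⟩ := exists_jointSource_factors A C hτ hprod
  choose N hN hNid hNsplit using fun i => exists_split_onQubit A hA (pauli i) (hQ i) (hQA i)
  simp only [fun i => trace_tensorMap_jointSource_mul A C Φ hJ (hNsplit i)]
  have hsub := fun M N : Matrix (Fin 2) (Fin 2) ℂ =>
    Matrix.submatrix_mul_equiv M N (Fin.cast hA) (finCongr hA) (Fin.cast hA)
  refine steering_bound (IsChoi.of_channel (hΦ A)) (fun i => (isHermitian_pauli i).submatrix _)
    (fun i => ?_) (fun i j hij => ?_) (fun i => isContr_effectiveObs hΦ hκ (hN i))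
    (fun i j hij => IdAt.commute fun u => ?_) hω c
  · refine (hsub _ _).trans ?_
    rw [pauli_mul_self]
    exact Matrix.submatrix_one _ (finCongr hA).injective
  · refine (hsub _ _).trans ?_
    rw [pauli_anticommute i j hij]
    exact congrArg Neg.neg (hsub _ _).symm
  · by_cases hu : u.1 = C
    · exact Or.inl (idAt_effectiveObs hΦ fun h => absurd hu h)
    · exact (hQdisj i j hij u.1 hu).imp (fun h => idAt_effectiveObs hΦ fun _ => hNid i u h)
        (fun h => idAt_effectiveObs hΦ fun _ => hNid j u h)

omit [Fintype V] [Fintype S] [DecidableEq S] in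
/-- A separable source is a mixture of product sources; sources not reaching both `A` and `C` are
left as they are. -/
theorem exists_mixture (A C : V) {s : S}
    {σ : Matrix (∀ v : {v // v ∈ parties s}, Fin (D s v.1))
      (∀ v : {v // v ∈ parties s}, Fin (D s v.1)) ℂ} (hσ : IsDensity σ)
    (hsep : A ∈ parties s → C ∈ parties s → IsSeparable σ) :
    ∃ (k : ℕ) (q : Fin k → ℝ) (τ : Fin k → Matrix (∀ v : {v // v ∈ parties s}, Fin (D s v.1))
      (∀ v : {v // v ∈ parties s}, Fin (D s v.1)) ℂ),
      (∀ i, 0 ≤ q i) ∧ ∑ i, q i = 1 ∧ (∀ i, IsDensity (τ i)) ∧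
      (∀ i, A ∈ parties s → C ∈ parties s → ∃ ω : ∀ v : {v // v ∈ parties s},
        Matrix (Fin (D s v.1)) (Fin (D s v.1)) ℂ, (∀ v, IsDensity (ω v)) ∧ τ i = tensor ω) ∧
      σ = ∑ i, (q i : ℂ) • τ i := by
  by_cases h : A ∈ parties s ∧ C ∈ parties s
  · obtain ⟨k, q, ω, hq, hq1, hω, rfl⟩ := hsep h.1 h.2
    exact ⟨k, q, fun i => tensor (ω i), hq, hq1, fun i => IsDensity.tensor (hω i),
      fun i _ _ => ⟨ω i, hω i, rfl⟩, rfl⟩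
  · exact ⟨1, fun _ => 1, fun _ => σ, by simp, by simp, fun _ => hσ,
      fun _ h1 h2 => absurd ⟨h1, h2⟩ h, by simp⟩

omit [Fintype V] in
theorem jointSource_sum {k : S → ℕ} (q : ∀ s, Fin (k s) → ℂ)
    (τ : ∀ s, Fin (k s) → Matrix (∀ v : {v // v ∈ parties s}, Fin (D s v.1))
      (∀ v : {v // v ∈ parties s}, Fin (D s v.1)) ℂ) :
    jointSource parties D (fun s => ∑ i, q s i • τ s i) =
      ∑ f : ∀ s, Fin (k s), (∏ s, q s (f s)) • jointSource parties D fun s => τ s (f s) := by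
  ext x y
  simp only [jointSource, Matrix.of_apply, Matrix.sum_apply, Matrix.smul_apply, smul_eq_mul,
    Finset.prod_univ_sum, Fintype.piFinset_univ, Finset.prod_mul_distrib]

/-- By multilinearity the joint state is a mixture over one choice of component per source, with
product weights. The bound for fixed `c` is averaged over these choices. -/
theorem separable_network_bound (A C : V) (hA : d A = 2)
    {σ : ∀ s, Matrix (∀ v : {v // v ∈ parties s}, Fin (D s v.1))
      (∀ v : {v // v ∈ parties s}, Fin (D s v.1)) ℂ} (hσ : ∀ s, IsDensity (σ s))
    (hsep : ∀ s, A ∈ parties s → C ∈ parties s → IsSeparable (σ s))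
    {Φ : ∀ v, Matrix (InputIndex parties D v) (InputIndex parties D v) ℂ →ₗ[ℂ]
      Matrix (Fin (d v)) (Fin (d v)) ℂ} (hΦ : ∀ v, IsChannel (Φ v))
    {Q : Fin 3 → Matrix (∀ v, Fin (d v)) (∀ v, Fin (d v)) ℂ} (hQ : ∀ i, IsContr (Q i))
    (hQA : ∀ i, IdAt A (Q i))
    (hQdisj : ∀ i j, i ≠ j → ∀ w, w ≠ C → IdAt w (Q i) ∨ IdAt w (Q j)) (c : Fin 3 → ℝ) :
    2 * ∑ i, c i * mean (tensorMap Φ (jointSource parties D σ))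
      (onQubit A hA (pauli i) * Q i) ≤ 1 + ∑ i, c i ^ 2 := by
  choose k q τ hq hq1 hτ hτprod hσeq using fun s => exists_mixture A C (hσ s) (hsep s)
  have hbound := fun f : ∀ s, Fin (k s) => product_network_bound A C hA (fun s => hτ s (f s))
    (fun s => hτprod s (f s)) hΦ hQ hQA hQdisj c
  have hlin : ∀ i, mean (tensorMap Φ (jointSource parties D σ)) (onQubit A hA (pauli i) * Q i) =
      ∑ f : ∀ s, Fin (k s), (∏ s, q s (f s)) * (tensorMap Φ (jointSource parties D
        fun s => τ s (f s)) * (onQubit A hA (pauli i) * Q i)).trace.re := by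
    intro i
    rw [mean, funext hσeq, jointSource_sum (fun s i => (q s i : ℂ)), trace_tensorMap_mul,
      Finset.sum_mul, Matrix.trace_sum, Complex.re_sum]
    refine Finset.sum_congr rfl fun f _ => ?_
    rw [Matrix.smul_mul, Matrix.trace_smul, ← trace_tensorMap_mul, smul_eq_mul,
      ← Complex.ofReal_prod, Complex.re_ofReal_mul]
  have htot : ∑ f : ∀ s, Fin (k s), ∏ s, q s (f s) = 1 := by
    rw [← Fintype.piFinset_univ, ← Finset.prod_univ_sum]
    simp [hq1]
  calc _ = ∑ f : ∀ s, Fin (k s), (∏ s, q s (f s)) * (2 * ∑ i, c i * (tensorMap Φ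
        (jointSource parties D fun s => τ s (f s)) *
          (onQubit A hA (pauli i) * Q i)).trace.re) := by
        simp only [hlin, Finset.mul_sum]
        rw [Finset.sum_comm]
        exact Finset.sum_congr rfl fun f _ => Finset.sum_congr rfl fun i _ => by ring
    _ ≤ ∑ f : ∀ s, Fin (k s), (∏ s, q s (f s)) * (1 + ∑ i, c i ^ 2) :=
        Finset.sum_le_sum fun f _ => mul_le_mul_of_nonneg_left (hbound f)
          (Finset.prod_nonneg fun s _ => hq s (f s))
    _ = 1 + ∑ i, c i ^ 2 := by rw [← Finset.sum_mul, htot, one_mul]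

theorem hasSum_mean {n ι : Type*} [Fintype n] {f : ι → Matrix n n ℂ} {ρ : Matrix n n ℂ}
    (h : HasSum f ρ) (M : Matrix n n ℂ) : HasSum (fun l => mean (f l) M) (mean ρ M) := by
  let L : Matrix n n ℂ →+ ℝ := AddMonoidHom.mk' (fun X => mean X M) fun X Y => by
    simp [mean, add_mul]
  have hL : Continuous L := by
    change Continuous fun X : Matrix n n ℂ => (X * M).trace.re
    fun_prop
  exact h.map L hL

theorem mean_smul {n : Type*} [Fintype n] (r : ℝ) (ρ M : Matrix n n ℂ) :
    mean ((r : ℂ) • ρ) M = r * mean ρ M := by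
  simp [mean]

theorem Preparation.sum_sq_mean_le {ρ : Matrix (∀ v, Fin (d v)) (∀ v, Fin (d v)) ℂ}
    (prep : Preparation parties d ρ) (A C : V) (hA : d A = 2)
    (hsep : ∀ s, A ∈ parties s → C ∈ parties s → IsSeparable (prep.source s))
    {Q : Fin 3 → Matrix (∀ v, Fin (d v)) (∀ v, Fin (d v)) ℂ} (hQ : ∀ i, IsContr (Q i))
    (hQA : ∀ i, IdAt A (Q i))
    (hQdisj : ∀ i j, i ≠ j → ∀ w, w ≠ C → IdAt w (Q i) ∨ IdAt w (Q j)) :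
    ∑ i, mean ρ (onQubit A hA (pauli i) * Q i) ^ 2 ≤ 1 := by
  -- The optimal coefficients: the averaged linear bound becomes `2 ∑ c i² ≤ 1 + ∑ c i²`. They
  -- depend on `ρ` only, hence not on the shared randomness.
  set c : Fin 3 → ℝ := fun i => mean ρ (onQubit A hA (pauli i) * Q i) with hc
  have h1 : HasSum (fun l => 2 * ∑ i, c i * mean ((prep.prob l : ℂ) • tensorMap (prep.channel l)
      (jointSource parties prep.D prep.source)) (onQubit A hA (pauli i) * Q i))
      (2 * ∑ i, c i * c i) :=
    (hasSum_sum fun i _ => (hasSum_mean prep.state_eq _).mul_left (c i)).mul_left 2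
  have h2 := hasSum_le (fun l => ?_) h1 (prep.prob_sum.mul_right (1 + ∑ i, c i ^ 2))
  · simp only [← pow_two] at h2
    linarith
  · have := mul_le_mul_of_nonneg_left (separable_network_bound A C hA prep.source_isDensity hsep
      (prep.channel_isChannel l) hQ hQA hQdisj c) (prep.prob_nonneg l)
    refine le_trans (le_of_eq ?_) this
    simp only [mean_smul, Finset.mul_sum]
    exact Finset.sum_congr rfl fun i _ => by ring

theorem isContr_onQubit_mul_onSet (C : V) (hC : d C = 2) (i : Fin 3) {R : Finset V} (hR : C ∉ R)
    {P : Matrix (∀ v : {v // v ∈ R}, Fin (d v.1)) (∀ v : {v // v ∈ R}, Fin (d v.1)) ℂ}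
    (hP : IsBoundedObservable P) : IsContr (onQubit C hC (pauli i) * onSet R P) := by
  refine IsContr.mul_of_commute (isHermitian_onQubit C hC (isHermitian_pauli i))
    (onQubit_mul_self C hC (pauli_mul_self i)) (isContr_onSet R hP.2) (IdAt.commute fun w => ?_)
  by_cases hw : w = C
  · exact Or.inr (hw ▸ idAt_onSet R P hR)
  · exact Or.inl (idAt_onQubit C hC _ hw)

end Network

end QNetwork

end

/-! ### Link certification -/

theorem mainTheorem5 {V S : Type*} [Fintype V] [DecidableEq V] [Fintype S] [DecidableEq S]
    (parties : S → Finset V) (hbipartite : ∀ s, (parties s).card = 2)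
    (d : V → ℕ) (A C : V) (hAC : A ≠ C) (hA : d A = 2) (hC : d C = 2)
    (R₁ R₂ R₃ : Finset V)
    (hR₁ : A ∉ R₁ ∧ C ∉ R₁) (hR₂ : A ∉ R₂ ∧ C ∉ R₂) (hR₃ : A ∉ R₃ ∧ C ∉ R₃)
    (h₁₂ : Disjoint R₁ R₂) (h₁₃ : Disjoint R₁ R₃) (h₂₃ : Disjoint R₂ R₃)
    (P₁ : Matrix (∀ v : {v // v ∈ R₁}, Fin (d v.1)) (∀ v : {v // v ∈ R₁}, Fin (d v.1)) ℂ)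
    (P₂ : Matrix (∀ v : {v // v ∈ R₂}, Fin (d v.1)) (∀ v : {v // v ∈ R₂}, Fin (d v.1)) ℂ)
    (P₃ : Matrix (∀ v : {v // v ∈ R₃}, Fin (d v.1)) (∀ v : {v // v ∈ R₃}, Fin (d v.1)) ℂ)
    (hP₁ : QNetwork.IsBoundedObservable P₁) (hP₂ : QNetwork.IsBoundedObservable P₂)
    (hP₃ : QNetwork.IsBoundedObservable P₃)
    (ρ : Matrix (∀ v, Fin (d v)) (∀ v, Fin (d v)) ℂ) :
    ((∀ s, parties s ≠ {A, C}) → QNetwork.IsPreparable parties d ρ →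
      QNetwork.mean ρ (QNetwork.onQubit A hA QNetwork.pauliX *
          QNetwork.onQubit C hC QNetwork.pauliX * QNetwork.onSet R₁ P₁) ^ 2
        + QNetwork.mean ρ (QNetwork.onQubit A hA QNetwork.pauliY *
          QNetwork.onQubit C hC QNetwork.pauliY * QNetwork.onSet R₂ P₂) ^ 2
        + QNetwork.mean ρ (QNetwork.onQubit A hA QNetwork.pauliZ *
          QNetwork.onQubit C hC QNetwork.pauliZ * QNetwork.onSet R₃ P₃) ^ 2 ≤ 1) ∧
    (∀ prep : QNetwork.Preparation parties d ρ,
      1 < QNetwork.mean ρ (QNetwork.onQubit A hA QNetwork.pauliX *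
          QNetwork.onQubit C hC QNetwork.pauliX * QNetwork.onSet R₁ P₁) ^ 2
        + QNetwork.mean ρ (QNetwork.onQubit A hA QNetwork.pauliY *
          QNetwork.onQubit C hC QNetwork.pauliY * QNetwork.onSet R₂ P₂) ^ 2
        + QNetwork.mean ρ (QNetwork.onQubit A hA QNetwork.pauliZ *
          QNetwork.onQubit C hC QNetwork.pauliZ * QNetwork.onSet R₃ P₃) ^ 2 →
      ∃ s, parties s = {A, C} ∧ ¬ QNetwork.IsSeparable (prep.source s)) := by
  have key : ∀ prep : QNetwork.Preparation parties d ρ,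
      (∀ s, A ∈ parties s → C ∈ parties s → QNetwork.IsSeparable (prep.source s)) →
      QNetwork.mean ρ (QNetwork.onQubit A hA QNetwork.pauliX *
          QNetwork.onQubit C hC QNetwork.pauliX * QNetwork.onSet R₁ P₁) ^ 2
        + QNetwork.mean ρ (QNetwork.onQubit A hA QNetwork.pauliY *
          QNetwork.onQubit C hC QNetwork.pauliY * QNetwork.onSet R₂ P₂) ^ 2
        + QNetwork.mean ρ (QNetwork.onQubit A hA QNetwork.pauliZ *
          QNetwork.onQubit C hC QNetwork.pauliZ * QNetwork.onSet R₃ P₃) ^ 2 ≤ 1 := by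
    intro prep hsep
    let Q : Fin 3 → Matrix (∀ v, Fin (d v)) (∀ v, Fin (d v)) ℂ :=
      ![QNetwork.onQubit C hC QNetwork.pauliX * QNetwork.onSet R₁ P₁,
        QNetwork.onQubit C hC QNetwork.pauliY * QNetwork.onSet R₂ P₂,
        QNetwork.onQubit C hC QNetwork.pauliZ * QNetwork.onSet R₃ P₃]
    let R : Fin 3 → Finset V := ![R₁, R₂, R₃]
    have hQ : ∀ i, QNetwork.IsContr (Q i) := Fin.forall_fin_succ.2
      ⟨QNetwork.isContr_onQubit_mul_onSet C hC 0 hR₁.2 hP₁, Fin.forall_fin_two.2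
        ⟨QNetwork.isContr_onQubit_mul_onSet C hC 1 hR₂.2 hP₂,
          QNetwork.isContr_onQubit_mul_onSet C hC 2 hR₃.2 hP₃⟩⟩
    have hid : ∀ i w, w ≠ C → w ∉ R i → QNetwork.IdAt w (Q i) := Fin.forall_fin_succ.2
      ⟨fun w hw hR => QNetwork.idAt_onQubit_mul C hC _ (QNetwork.idAt_onSet R₁ P₁ hR₁.2) hw
        (QNetwork.idAt_onSet R₁ P₁ hR), Fin.forall_fin_two.2
      ⟨fun w hw hR => QNetwork.idAt_onQubit_mul C hC _ (QNetwork.idAt_onSet R₂ P₂ hR₂.2) hw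
        (QNetwork.idAt_onSet R₂ P₂ hR),
      fun w hw hR => QNetwork.idAt_onQubit_mul C hC _ (QNetwork.idAt_onSet R₃ P₃ hR₃.2) hw
        (QNetwork.idAt_onSet R₃ P₃ hR)⟩⟩
    have hAR : ∀ i, A ∉ R i := Fin.forall_fin_succ.2 ⟨hR₁.1, Fin.forall_fin_two.2 ⟨hR₂.1, hR₃.1⟩⟩
    have hdisj : ∀ i j, i ≠ j → Disjoint (R i) (R j) := by
      intro i j hij
      fin_cases i <;> fin_cases j <;> first
        | exact absurd rfl hij
        | assumption
        | exact Disjoint.symm (by assumption)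
    have h := prep.sum_sq_mean_le A C hA hsep hQ (fun i => hid i A hAC (hAR i))
      (fun i j hij w hw => by
        by_cases hwi : w ∈ R i
        · exact Or.inr (hid j w hw (Finset.disjoint_left.1 (hdisj i j hij) hwi))
        · exact Or.inl (hid i w hw hwi))
    simpa [Fin.sum_univ_three, Q, QNetwork.pauli, mul_assoc] using h
  -- The only place where bipartiteness enters: it identifies the sources reaching both parties with
  -- the links between them.
  have hpair : ∀ s, A ∈ parties s → C ∈ parties s → parties s = {A, C} := by
    intro s h1 h2
    refine (Finset.eq_of_subset_of_card_le ?_ ?_).symm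
    · exact Finset.insert_subset h1 (Finset.singleton_subset_iff.2 h2)
    · rw [hbipartite, Finset.card_pair hAC]
  refine ⟨fun hno ⟨prep⟩ => key prep fun s h1 h2 => absurd (hpair s h1 h2) (hno s),
    fun prep hviol => ?_⟩
  by_contra! hcon
  exact absurd (key prep fun s h1 h2 => hcon s (hpair s h1 h2)) (not_le.2 hviol)
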